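/- Let $p,r\in\mathbb N$ and let $T=(p_{ij})$ be an irreducible and aperiodic $r\times r$ stochastic matrix with stationary distribution $\rho=(\rho_1,\dots,\rho_r)$. Let $B_1,\dots,B_r$ and $\Sigma_1,\dots,\Sigma_r$ be real $p\times p$ matrices, and let $\nu_1,\dots,\nu_r$ be probability measures on $\mathbb R^p$ with zero mean and identity covariance matrix. An SVAR process with these parameters is a process $(X_n)_{n\ge 0}$ in $\mathbb R^p$, on some probability space, with $$X_n=A_nX_{n-1}+E_n\quad(n\ge 1),\qquad A_n=\sum_{i=1}^r B_i1_{\{I_n=i\}},\qquad E_n=\sum_{i=1}^r\Sigma_i\varepsilon_{ni}1_{\{I_n=i\}},$$ where $(I_n)_{n\ge0}$ is a Markov chain on $\{1,\dots,r\}$ with transition matrix $T$ and arbitrary initial law, the random vectors $\varepsilon_{ni}$ ($n\ge0$, $1\le i\le r$) are independent, $\varepsilon_{ni}$ has law $\nu_i$, the chain $(I_n)$ is independent of the family $(\varepsilon_{ni})$, and $X_0$ is an arbitrary random vector. Let $\|\cdot\|$ be a matrix norm on $\mathbb R^{p\times p}$ (a norm with $\|AB\|\le\|A\|\,\|B\|$)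 such that $$\text{(CB)}\qquad \mathrm E\log\|A_1\|=\sum_{i=1}^r\rho_i\log\|B_i\|<0,$$ where the expectation is taken under the stationary regime law ($I_1\sim\rho$) and $\log 0=-\infty$. Then the SVAR process is stable: there is exactly one probability measure $\pi$ on $\mathbb R^p$ such that, for every SVAR process with these parameters, whatever the law of $I_0$ and whatever the random vector $X_0$, the law of $X_n$ converges weakly to $\pi$ as $n\to\infty$. -/

import Mathlib

open MeasureTheory ProbabilityTheory Filter Topology Matrix

universe u

noncomputable section

/-- Aperiodicity of a finite-state transition matrix: for every state `i`, the greatest common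
divisor of the possible return times `{n ≥ 1 | (Pⁿ)ᵢᵢ > 0}` is `1`. -/
def IsAperiodic {r : ℕ} (T : Matrix (Fin r) (Fin r) ℝ) : Prop :=
  ∀ i : Fin r, ∀ d : ℕ, (∀ n : ℕ, 1 ≤ n → 0 < (T ^ n) i i → d ∣ n) → d = 1

/-- `ρ` is a stationary probability vector of the transition matrix `T`. -/
structure IsStationaryDistribution {r : ℕ} (T : Matrix (Fin r) (Fin r) ℝ) (ρ : Fin r → ℝ) :
    Prop where
  nonneg : ∀ i, 0 ≤ ρ i
  sum_eq_one : ∑ i, ρ i = 1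
  stationary : ρ ᵥ* T = ρ

/-- The process `I` is a Markov chain with transition matrix `T` (and arbitrary initial law):
`P(I₀ = s₀, …, Iₙ₊₁ = sₙ₊₁) = P(I₀ = s₀, …, Iₙ = sₙ) T(sₙ, sₙ₊₁)` for every path `s`. -/
structure IsMarkovChain {r : ℕ} {Ω : Type*} [MeasurableSpace Ω] (P : Measure Ω)
    (T : Matrix (Fin r) (Fin r) ℝ) (I : ℕ → Ω → Fin r) : Prop where
  measurable : ∀ n, Measurable (I n)
  markov : ∀ (n : ℕ) (s : ℕ → Fin r),
    P.real {ω | ∀ k ≤ n + 1, I k ω = s k} =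
      P.real {ω | ∀ k ≤ n, I k ω = s k} * T (s n) (s (n + 1))

/-- The parameters of a Markov switching vector AR(1) model in `ℝᵖ` with `r` regimes: the
transition matrix of the regime chain (irreducible and aperiodic), the autoregression matrices
`B i`, the noise matrices `S i`, and the law `ν i` of the noise vectors used in regime `i`,
which has zero mean and identity covariance matrix. -/
structure SVARModel (p r : ℕ) where
  T : Matrix (Fin r) (Fin r) ℝ
  B : Fin r → Matrix (Fin p) (Fin p) ℝ
  S : Fin r → Matrix (Fin p) (Fin p) ℝ
  ν : Fin r → Measure (Fin p → ℝ)
  stochastic : T ∈ rowStochastic ℝ (Fin r)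
  irreducible : T.IsIrreducible
  aperiodic : IsAperiodic T
  noise_prob : ∀ i, IsProbabilityMeasure (ν i)
  noise_memLp : ∀ i a, MemLp (fun x : Fin p → ℝ => x a) 2 (ν i)
  noise_mean : ∀ i a, ∫ x, x a ∂(ν i) = 0
  noise_cov : ∀ i a b,
    cov[fun x : Fin p → ℝ => x a, fun x : Fin p → ℝ => x b; ν i] =
      (1 : Matrix (Fin p) (Fin p) ℝ) a b

namespace SVARModel

variable {p r : ℕ}

/-- The random coefficient matrix `Aₙ = ∑ᵢ Bᵢ 1{Iₙ = i}`. -/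
def A (M : SVARModel p r) {Ω : Type*} (I : ℕ → Ω → Fin r) (n : ℕ) (ω : Ω) :
    Matrix (Fin p) (Fin p) ℝ :=
  ∑ i, if I n ω = i then M.B i else 0

/-- The noise vector `Eₙ = ∑ᵢ Σᵢ εₙᵢ 1{Iₙ = i}`. -/
def E (M : SVARModel p r) {Ω : Type*} (I : ℕ → Ω → Fin r) (ε : ℕ → Fin r → Ω → Fin p → ℝ)
    (n : ℕ) (ω : Ω) : Fin p → ℝ :=
  ∑ i, if I n ω = i then M.S i *ᵥ ε n i ω else 0

/-- `X` is an SVAR process for the model `M`, started at time `0`, driven by the regime chain `I`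
and the noises `ε n i`. The law of `I 0` and the random vector `X 0` are arbitrary. -/
structure IsSVAR (M : SVARModel p r) {Ω : Type*} [MeasurableSpace Ω] (P : Measure Ω)
    (I : ℕ → Ω → Fin r) (ε : ℕ → Fin r → Ω → Fin p → ℝ) (X : ℕ → Ω → Fin p → ℝ) : Prop where
  chain : IsMarkovChain P M.T I
  noise_measurable : ∀ n i, Measurable (ε n i)
  noise_law : ∀ n i, P.map (ε n i) = M.ν i
  noise_indep : iIndepFun (fun (ni : ℕ × Fin r) => ε ni.1 ni.2) P
  chain_indep_noise :
    IndepFun (fun ω (n : ℕ) => I n ω) (fun ω (ni : ℕ × Fin r) => ε ni.1 ni.2 ω) P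
  init_measurable : Measurable (X 0)
  recursion : ∀ n ω, X (n + 1) ω = M.A I (n + 1) ω *ᵥ X n ω + M.E I ε (n + 1) ω

/-- `E log ‖A₁‖` for the matrix norm `N`, when the regime `I₁` has the law `ρ`, as an
extended real number with `log 0 = -∞`: since `A₁ = Bᵢ` with probability `ρᵢ`, this is the
finite sum `∑ᵢ ρᵢ log ‖Bᵢ‖` (with `0 · (-∞) = 0`). -/
def expectLogNorm (M : SVARModel p r) (N : AlgebraNorm ℝ (Matrix (Fin p) (Fin p) ℝ))
    (ρ : Fin r → ℝ) : EReal :=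
  ∑ i, (ρ i : EReal) * ENNReal.log (ENNReal.ofReal (N (M.B i)))

/-- Stability: there is exactly one probability measure `π` on `ℝᵖ` to which the law of `Xₙ`
converges weakly for every SVAR process of the model, whatever its initial regime law
and its starting vector. -/
def IsStable (M : SVARModel p r) : Prop :=
  ∃! π : ProbabilityMeasure (Fin p → ℝ),
    ∀ (Ω : Type u) [MeasurableSpace Ω] (P : Measure Ω) [IsProbabilityMeasure P]
      (I : ℕ → Ω → Fin r) (ε : ℕ → Fin r → Ω → Fin p → ℝ) (X : ℕ → Ω → Fin p → ℝ),
      M.IsSVAR P I ε X →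
        TendstoInDistribution X atTop id (fun _ => P) (π : Measure (Fin p → ℝ))

end SVARModel

end

open scoped ENNReal NNReal

/-! The mechanism is a contraction on average. The negative drift of `log ‖A‖` becomes the
contraction of a small power of a norm: at exponent `s = 0` the kernel `T i j * b j ^ s` fixes
constants, and its first-order perturbation in `s` is governed by `∑ ρ i log (b i) < 0`. This gives
`h > 0`, `s ∈ (0, 1]` and `θ < 1` with `∑ j, T i j * (b j ^ s * h j) ≤ θ * h i`
(`exists_rpow_contraction`). With a vector norm `q` compatible with `N`, the weight `D = q ^ s` is
subadditive, and two copies driven by the same regimes and noises approach each other at rate `θ` in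
the mean of `h * D`.

As `X 0` may depend on the whole future, `(Iₙ, Xₙ)` need not be Markov. It is compared with the
process `Y` started from `0`, a function of regimes and noises alone: `D (Xₙ - Yₙ)` is at most a
product of contraction factors times `D (X 0)`, and tends to `0` almost surely.

For `Y`, with transition operator `Q` and a bounded Lipschitz `ψ`, `E ψ(I_{m+n}, Y_{m+n}) = E
(Qⁿψ)(I_m, Y_m)`. This is within `O(θⁿ)` of `E (Qⁿψ)(I_m, 0)`, uniformly in `m`, and as `m → ∞` the
regime chain equilibrates to `∑ ρ i (Qⁿψ)(i, 0)`, which does not depend on the process. So all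
processes share the limits of their integrals (`tendsto_lintegral_zeroStart`). Tightness of one
concrete process shows that these limits come from a probability measure. -/

/-! ### Positive powers and convergence to equilibrium of the regime chain. -/

theorem Matrix.pow_apply_pos_of_pos_of_pos {ι : Type*} [Fintype ι] [DecidableEq ι]
    {T : Matrix ι ι ℝ} (hT : ∀ i j, 0 ≤ T i j) {m n : ℕ} {i j k : ι}
    (h₁ : 0 < (T ^ m) i j) (h₂ : 0 < (T ^ n) j k) : 0 < (T ^ (m + n)) i k := by
  rw [pow_add, Matrix.mul_apply]
  exact (Finset.sum_pos_iff_of_nonneg fun x _ =>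
    mul_nonneg (Matrix.pow_apply_nonneg hT m i x) (Matrix.pow_apply_nonneg hT n x k)).2
    ⟨j, Finset.mem_univ j, mul_pos h₁ h₂⟩

/-- Return times are closed under addition and have gcd `1`, so they contain all large integers. -/
theorem IsAperiodic.eventually_pow_apply_self_pos {r : ℕ} {T : Matrix (Fin r) (Fin r) ℝ}
    (hT : ∀ i j, 0 ≤ T i j) (hper : IsAperiodic T) (i : Fin r) :
    ∃ n₀, ∀ n ≥ n₀, 0 < (T ^ n) i i := by
  set s : Set ℕ := {n | 1 ≤ n ∧ 0 < (T ^ n) i i}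
  have hs : Nat.setGcd s = 1 := hper i _ fun n hn hpos => Nat.setGcd_dvd_of_mem ⟨hn, hpos⟩
  obtain ⟨n₀, hn₀⟩ := Nat.exists_mem_closure_of_ge s
  refine ⟨n₀, fun n hn => ?_⟩
  have hmem := hn₀ n hn (by rw [hs]; exact one_dvd n)
  clear hn
  induction hmem using AddSubmonoid.closure_induction with
  | mem x hx => exact hx.2
  | zero => simp
  | add x y _ _ hx hy => exact Matrix.pow_apply_pos_of_pos_of_pos hT hx hy

/-- An irreducible and aperiodic nonnegative matrix has a power with positive entries. -/
theorem Matrix.IsIrreducible.exists_pow_pos_of_isAperiodic {r : ℕ}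
    {T : Matrix (Fin r) (Fin r) ℝ} (hirr : T.IsIrreducible) (hper : IsAperiodic T) :
    ∃ k, ∀ i j, 0 < (T ^ k) i j := by
  have hT := hirr.nonneg
  choose n₀ hn₀ using hper.eventually_pow_apply_self_pos hT
  choose k _ hk using (Matrix.isIrreducible_iff_exists_pow_pos hT).1 hirr
  -- A common exponent: return to `i` in the surplus time, which is at least `n₀ i`, then go to `j`
  -- in `k i j` steps.
  refine ⟨∑ i, n₀ i + ∑ i, ∑ j, k i j, fun i j => ?_⟩
  have h₁ : n₀ i ≤ ∑ i, n₀ i := Finset.single_le_sum (fun _ _ => Nat.zero_le _) (Finset.mem_univ i)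
  have h₂ : k i j ≤ ∑ i, ∑ j, k i j :=
    (Finset.single_le_sum (f := fun j => k i j) (fun _ _ => Nat.zero_le _) (Finset.mem_univ j)).trans
      (Finset.single_le_sum (f := fun i => ∑ j, k i j) (fun _ _ => Nat.zero_le _)
        (Finset.mem_univ i))
  have h := Matrix.pow_apply_pos_of_pos_of_pos hT
    (hn₀ i (∑ i, n₀ i + ∑ i, ∑ j, k i j - k i j) (by omega)) (hk i j)
  rwa [Nat.sub_add_cancel (by omega)] at h

namespace IsStationaryDistribution

variable {r : ℕ} {T : Matrix (Fin r) (Fin r) ℝ} {ρ : Fin r → ℝ}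

theorem vecMul_pow (hρ : IsStationaryDistribution T ρ) (n : ℕ) : ρ ᵥ* T ^ n = ρ := by
  induction n with
  | zero => simp
  | succ n ih => rw [pow_succ, ← Matrix.vecMul_vecMul, ih, hρ.stationary]

theorem le_one (hρ : IsStationaryDistribution T ρ) (i : Fin r) : ρ i ≤ 1 :=
  hρ.sum_eq_one ▸ Finset.single_le_sum (fun j _ => hρ.nonneg j) (Finset.mem_univ i)

theorem pos (hρ : IsStationaryDistribution T ρ) {k : ℕ} (hk : ∀ i j, 0 < (T ^ k) i j)
    (i : Fin r) : 0 < ρ i := by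
  rw [← hρ.vecMul_pow k]
  obtain ⟨j, hj⟩ : ∃ j, 0 < ρ j := by
    by_contra! h
    have := hρ.sum_eq_one
    rw [Finset.sum_eq_zero fun j _ => le_antisymm (h j) (hρ.nonneg j)] at this
    exact zero_ne_one this
  exact (Finset.sum_pos_iff_of_nonneg fun x _ => mul_nonneg (hρ.nonneg x) (hk x i).le).2
    ⟨j, Finset.mem_univ j, mul_pos hj (hk j i)⟩

/-- Convergence to equilibrium, in the form `Tⁿ f → ∑ i, ρ i f i`. -/
theorem tendsto_pow_mulVec (hρ : IsStationaryDistribution T ρ) (hT : T ∈ rowStochastic ℝ (Fin r))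
    {k : ℕ} (hk : ∀ i j, 0 < (T ^ k) i j) (f : Fin r → ℝ) (i : Fin r) :
    Tendsto (fun n => (T ^ n *ᵥ f) i) atTop (𝓝 (ρ ⬝ᵥ f)) := by
  obtain ⟨δ, hδ0, hδ1, hδ⟩ : ∃ δ : ℝ, 0 < δ ∧ δ < 1 ∧ ∀ i j, δ ≤ (T ^ k) i j := by
    have h : ∀ᶠ δ : ℝ in 𝓝[>] 0, 0 < δ ∧ δ < 1 ∧ ∀ i j, δ ≤ (T ^ k) i j := by
      refine eventually_mem_nhdsWithin.and (Filter.Eventually.and ?_ ?_)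
      · exact nhdsWithin_le_nhds (eventually_lt_nhds one_pos)
      · refine Filter.eventually_all.2 fun i => Filter.eventually_all.2 fun j => ?_
        exact nhdsWithin_le_nhds (eventually_le_nhds (hk i j))
    exact h.exists
  have hTp : ∀ n, T ^ n ∈ rowStochastic ℝ (Fin r) := fun n => pow_mem hT n
  set v : ℕ → Fin r → ℝ := fun n i => (T ^ n *ᵥ f) i - ρ ⬝ᵥ f with hv
  have hρv : ∀ n, ∑ i, ρ i * v n i = 0 := fun n => by
    have h : ∑ i, ρ i * (T ^ n *ᵥ f) i = ρ ⬝ᵥ f := by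
      change ρ ⬝ᵥ (T ^ n *ᵥ f) = _
      rw [Matrix.dotProduct_mulVec, hρ.vecMul_pow]
    simp only [hv, mul_sub, Finset.sum_sub_distrib, h, ← Finset.sum_mul, hρ.sum_eq_one, one_mul,
      sub_self]
  have hstep : ∀ m n i, v (n + m) i = ∑ j, (T ^ m) i j * v n j := fun m n i => by
    simp only [hv, mul_sub, Finset.sum_sub_distrib, ← Finset.sum_mul,
      sum_row_of_mem_rowStochastic (hTp m), one_mul, add_comm n m, pow_add, ← Matrix.mulVec_mulVec]
    rfl
  have hcontr : ∀ n, ‖v (n + k)‖ ≤ (1 - δ) * ‖v n‖ := fun n => by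
    refine (pi_norm_le_iff_of_nonneg (mul_nonneg (by linarith) (norm_nonneg _))).2 fun i => ?_
    -- Doeblin's argument: `v n` has `ρ`-mean zero, so `δ * ρ j` may be subtracted from each row of
    -- `T ^ k`. The remainder is nonnegative with row sums `1 - δ`.
    have h : v (n + k) i = ∑ j, ((T ^ k) i j - δ * ρ j) * v n j := by
      rw [hstep]
      simp only [sub_mul, Finset.sum_sub_distrib, mul_assoc, ← Finset.mul_sum, hρv]
      simp
    have hnn : ∀ j, 0 ≤ (T ^ k) i j - δ * ρ j := fun j => by
      nlinarith [hδ i j, hρ.le_one j]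
    rw [h]
    calc ‖∑ j, ((T ^ k) i j - δ * ρ j) * v n j‖
        ≤ ∑ j, ((T ^ k) i j - δ * ρ j) * ‖v n‖ := by
          refine norm_sum_le_of_le _ fun j _ => ?_
          rw [norm_mul, Real.norm_of_nonneg (hnn j)]
          exact mul_le_mul_of_nonneg_left (norm_le_pi_norm _ _) (hnn j)
      _ = (1 - δ) * ‖v n‖ := by
          rw [← Finset.sum_mul, Finset.sum_sub_distrib, sum_row_of_mem_rowStochastic (hTp k),
            ← Finset.mul_sum, hρ.sum_eq_one, mul_one]
  -- Monotonicity extends the geometric decay along multiples of `k` to all times.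
  have hanti : Antitone fun n => ‖v n‖ := antitone_nat_of_succ_le fun n => by
    refine (pi_norm_le_iff_of_nonneg (norm_nonneg _)).2 fun i => ?_
    rw [hstep]
    calc ‖∑ j, (T ^ 1) i j * v n j‖ ≤ ∑ j, (T ^ 1) i j * ‖v n‖ := by
          refine norm_sum_le_of_le _ fun j _ => ?_
          have hnn := nonneg_of_mem_rowStochastic (hTp 1) (i := i) (j := j)
          rw [norm_mul, Real.norm_of_nonneg hnn]
          exact mul_le_mul_of_nonneg_left (norm_le_pi_norm _ _) hnn
      _ = ‖v n‖ := by rw [← Finset.sum_mul, sum_row_of_mem_rowStochastic (hTp 1), one_mul]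
  have hgeom : ∀ n, ‖v (n * k)‖ ≤ (1 - δ) ^ n * ‖v 0‖ := fun n => by
    induction n with
    | zero => simp
    | succ n ih =>
      rw [Nat.succ_mul, pow_succ', mul_assoc]
      exact (hcontr _).trans (mul_le_mul_of_nonneg_left ih (by linarith))
  have hlim : Tendsto (fun n => ‖v n‖) atTop (𝓝 0) := by
    have hbdd : BddBelow (Set.range fun n => ‖v n‖) :=
      ⟨0, by rintro _ ⟨n, rfl⟩; exact norm_nonneg _⟩
    have h₁ := tendsto_atTop_ciInf hanti hbdd
    have h₂ : (⨅ n, ‖v n‖) = 0 := by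
      refine le_antisymm ?_ (le_ciInf fun n => norm_nonneg _)
      refine ge_of_tendsto' (f := fun n => (1 - δ) ^ n * ‖v 0‖) (x := atTop) ?_ fun n =>
        (ciInf_le hbdd _).trans (hgeom n)
      have h₃ := tendsto_pow_atTop_nhds_zero_of_lt_one (sub_nonneg.2 hδ1.le)
        (sub_lt_self 1 hδ0)
      simpa using h₃.mul_const ‖v 0‖
    rwa [h₂] at h₁
  have h := (tendsto_pi_nhds.1 (tendsto_zero_iff_norm_tendsto_zero.2 hlim) i).add_const (ρ ⬝ᵥ f)
  simpa [hv] using h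

end IsStationaryDistribution

/-! ### From negative logarithmic drift to contraction of a small power. -/

/-- A finite chain with negative mean logarithmic growth `∑ ρ i log (b i)` contracts a small
power of the growth factor in a weighted sup-norm. -/
theorem IsStationaryDistribution.exists_rpow_contraction {r : ℕ} {T : Matrix (Fin r) (Fin r) ℝ}
    {ρ : Fin r → ℝ} (hρ : IsStationaryDistribution T ρ) (hT : T ∈ rowStochastic ℝ (Fin r))
    {k : ℕ} (hk : ∀ i j, 0 < (T ^ k) i j) {b : Fin r → ℝ} (hb : ∀ i, 0 < b i)
    (hneg : ∑ i, ρ i * Real.log (b i) < 0) :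
    ∃ (s θ : ℝ) (h : Fin r → ℝ), 0 < s ∧ s ≤ 1 ∧ 0 < θ ∧ θ < 1 ∧ (∀ i, 0 < h i) ∧
      ∀ i, ∑ j, T i j * (b j ^ s * h j) ≤ θ * h i := by
  set f : Fin r → ℝ := fun i => Real.log (b i) with hf
  obtain ⟨n, hn⟩ : ∃ n, ∀ i, (T ^ (n + 1) *ᵥ f) i < 0 :=
    (Filter.eventually_all.2 fun i => ((hρ.tendsto_pow_mulVec hT hk f i).comp
      (tendsto_add_atTop_nat 1)).eventually_lt_const hneg).exists
  -- An approximate solution of the Poisson equation: the sum telescopes, so the corrector `g`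
  -- replaces the drift `T f`, whose sign may vary with the state, by `T ^ (n + 1) f`, negative
  -- everywhere.
  set g : Fin r → ℝ := ∑ m ∈ Finset.range n, T ^ (m + 1) *ᵥ f with hg
  have hTg : T *ᵥ f + T *ᵥ g - g = T ^ (n + 1) *ᵥ f := by
    have h₁ : T *ᵥ g = ∑ m ∈ Finset.range n, T ^ (m + 2) *ᵥ f := by
      rw [hg, ← Matrix.mulVecLin_apply, map_sum]
      refine Finset.sum_congr rfl fun m _ => ?_
      rw [Matrix.mulVecLin_apply, Matrix.mulVec_mulVec, ← pow_succ']
    have h₂ := Finset.sum_range_succ (fun m => T ^ (m + 1) *ᵥ f) n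
    rw [Finset.sum_range_succ', zero_add, pow_one] at h₂
    rw [h₁, hg, sub_eq_iff_eq_add, add_comm (T *ᵥ f), h₂, add_comm]
  -- With `h = 1 + s * g` the contraction defect vanishes at `s = 0` and has negative derivative
  -- there, so it is negative for small `s > 0`.
  have hderiv : ∀ i, HasDerivAt (fun s : ℝ => ∑ j, T i j * (Real.exp (f j * s) * (1 + s * g j))
      - (1 + s * g i)) ((T ^ (n + 1) *ᵥ f) i) 0 := fun i => by
    have h₁ : ∀ j, HasDerivAt (fun s : ℝ => 1 + s * g j) (g j) 0 := fun j => by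
      simpa using ((hasDerivAt_id (0 : ℝ)).mul_const (g j)).const_add 1
    have h₂ : ∀ j, HasDerivAt (fun s : ℝ => Real.exp (f j * s)) (f j) 0 := fun j => by
      simpa using ((hasDerivAt_id (0 : ℝ)).const_mul (f j)).exp
    have h₃ := (HasDerivAt.fun_sum (u := Finset.univ) fun j _ =>
      (((h₂ j).mul (h₁ j)).const_mul (T i j))).sub (h₁ i)
    refine h₃.congr_deriv ?_
    rw [← hTg]
    simp [Matrix.mulVec, dotProduct, mul_add, Finset.sum_add_distrib]
  have hneg' : ∀ i, ∀ᶠ s : ℝ in 𝓝[>] 0,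
      ∑ j, T i j * (Real.exp (f j * s) * (1 + s * g j)) < 1 + s * g i := fun i => by
    have h₁ := (hasDerivAt_iff_tendsto_slope.1 (hderiv i)).mono_left
      (nhdsWithin_mono (0 : ℝ) (fun x (hx : 0 < x) => ne_of_gt hx))
    filter_upwards [h₁.eventually_lt_const (hn i), self_mem_nhdsWithin] with s hs hs0
    have hs0 : 0 < s := hs0
    rw [slope_def_field, div_lt_iff₀ (by simpa using hs0)] at hs
    simp [sum_row_of_mem_rowStochastic hT] at hs
    exact hs
  have hpos : ∀ i, ∀ᶠ s : ℝ in 𝓝[>] 0, 0 < 1 + s * g i := fun i => by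
    have : Tendsto (fun s : ℝ => 1 + s * g i) (𝓝[>] 0) (𝓝 (1 + 0 * g i)) :=
      (Continuous.tendsto (by fun_prop) _).mono_left nhdsWithin_le_nhds
    exact this.eventually_const_lt (by simp)
  obtain ⟨s, ⟨⟨hs₁, hs₂⟩, hs₃⟩, hs₄⟩ := (((Filter.eventually_all.2 hneg').and
    (Filter.eventually_all.2 hpos)).and (nhdsWithin_le_nhds (eventually_lt_nhds one_pos))).and
    (self_mem_nhdsWithin : Set.Ioi (0 : ℝ) ∈ 𝓝[>] 0) |>.exists
  have hθ : ∀ᶠ θ : ℝ in 𝓝[<] 1, ∀ i,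
      ∑ j, T i j * (Real.exp (f j * s) * (1 + s * g j)) < θ * (1 + s * g i) :=
    Filter.eventually_all.2 fun i => by
      have : Tendsto (fun θ : ℝ => θ * (1 + s * g i)) (𝓝[<] 1) (𝓝 (1 * (1 + s * g i))) :=
        (Continuous.tendsto (by fun_prop) _).mono_left nhdsWithin_le_nhds
      exact this.eventually_const_lt (by simpa using hs₁ i)
  obtain ⟨θ, ⟨hθ₁, hθ₂⟩, hθ₃⟩ := ((hθ.and (nhdsWithin_le_nhds (eventually_gt_nhds one_pos))).and
    (self_mem_nhdsWithin : Set.Iio (1 : ℝ) ∈ 𝓝[<] 1)).exists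
  refine ⟨s, θ, fun i => 1 + s * g i, hs₄, hs₃.le, hθ₂, hθ₃, hs₂, fun i => ?_⟩
  have h : ∀ j, b j ^ s = Real.exp (f j * s) := fun j => Real.rpow_def_of_pos (hb j) s
  simpa only [h] using (hθ₁ i).le

/-- If `∑ ρ i log (a i) < 0` with the convention `log 0 = -∞`, the zero values of `a` can be
replaced by positive ones. -/
theorem exists_pos_bound_of_sum_log_neg {ι : Type*} [Fintype ι] {ρ a : ι → ℝ}
    (hρ : ∀ i, 0 < ρ i) (ha : ∀ i, 0 ≤ a i)
    (hneg : ∑ i, (ρ i : EReal) * ENNReal.log (ENNReal.ofReal (a i)) < 0) :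
    ∃ b : ι → ℝ, (∀ i, 0 < b i) ∧ (∀ i, a i ≤ b i) ∧ ∑ i, ρ i * Real.log (b i) < 0 := by
  classical
  by_cases hz : ∃ i, a i = 0
  · obtain ⟨i₀, hi₀⟩ := hz
    -- Each replaced zero contributes `t * ρ i`. As `ρ` is positive, the sum tends to `-∞` with `t`.
    set b : ℝ → ι → ℝ := fun t i => if a i = 0 then Real.exp t else a i with hbdef
    have hsum : ∀ t, ∑ i, ρ i * Real.log (b t i) =
        t * (∑ i, if a i = 0 then ρ i else 0) + ∑ i, ρ i * Real.log (a i) := fun t => by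
      rw [Finset.mul_sum, ← Finset.sum_add_distrib]
      refine Finset.sum_congr rfl fun i _ => ?_
      by_cases h : a i = 0 <;> simp [hbdef, h, mul_comm]
    have hR : 0 < ∑ i, if a i = 0 then ρ i else 0 := by
      refine Finset.sum_pos' (fun i _ => ?_) ⟨i₀, Finset.mem_univ _, by simp [hi₀, hρ]⟩
      split_ifs
      exacts [(hρ i).le, le_rfl]
    have hlim : Tendsto (fun t : ℝ => t * (∑ i, if a i = 0 then ρ i else 0) +
        ∑ i, ρ i * Real.log (a i)) atBot atBot :=
      tendsto_atBot_add_const_right _ _ (tendsto_id.atBot_mul_const hR)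
    obtain ⟨t, ht⟩ := (hlim.eventually_lt_atBot 0).exists
    refine ⟨b t, fun i => ?_, fun i => ?_, by rwa [hsum]⟩
    · by_cases h : a i = 0
      · simp [hbdef, h, Real.exp_pos]
      · simpa [hbdef, h] using lt_of_le_of_ne (ha i) (Ne.symm h)
    · by_cases h : a i = 0
      · simp [hbdef, h, (Real.exp_pos t).le]
      · simp [hbdef, h]
  · push Not at hz
    have hpos : ∀ i, 0 < a i := fun i => lt_of_le_of_ne (ha i) (hz i).symm
    refine ⟨a, hpos, fun i => le_rfl, ?_⟩
    have h : ∀ i, (ρ i : EReal) * ENNReal.log (ENNReal.ofReal (a i)) =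
        ((ρ i * Real.log (a i) : ℝ) : EReal) := fun i => by
      rw [ENNReal.log_ofReal_of_pos (hpos i), EReal.coe_mul]
    simp only [h] at hneg
    have hcoe : ∀ s : Finset ι, ∑ i ∈ s, ((ρ i * Real.log (a i) : ℝ) : EReal) =
        ((∑ i ∈ s, ρ i * Real.log (a i) : ℝ) : EReal) := fun s => by
      induction s using Finset.induction_on with
      | empty => simp
      | insert i s hi ih => rw [Finset.sum_insert hi, Finset.sum_insert hi, ih, EReal.coe_add]
    rw [hcoe] at hneg
    exact_mod_cast hneg

/-! ### The contracting weight built from the matrix norm. -/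

/-- A weight `D` (a power of a norm) which the random coefficients of the model contract on
average, after the regimes have been reweighted by `h`. -/
structure SVARModel.IsContractingWeight {p r : ℕ} (M : SVARModel p r)
    (D : (Fin p → ℝ) → ℝ≥0∞) (c h : Fin r → ℝ≥0∞) (θ C : ℝ≥0∞) (s : ℝ) : Prop where
  measurable : Measurable D
  map_zero : D 0 = 0
  ne_top : ∀ x, D x ≠ ∞
  add_le : ∀ x y, D (x + y) ≤ D x + D y
  map_neg : ∀ x, D (-x) = D x
  mulVec_le : ∀ j x, D (M.B j *ᵥ x) ≤ c j * D x
  lintegral_noise_ne_top : ∀ j, ∫⁻ e, D (M.S j *ᵥ e) ∂(M.ν j) ≠ ∞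
  one_le : ∀ i, 1 ≤ h i
  h_ne_top : ∀ i, h i ≠ ∞
  drift : ∀ i, ∑ j, ENNReal.ofReal (M.T i j) * (c j * h j) ≤ θ * h i
  lt_one : θ < 1
  exponent_pos : 0 < s
  exponent_le_one : s ≤ 1
  const_ne_top : C ≠ ∞
  rpow_le : ∀ x, ‖x‖ₑ ^ s ≤ C * D x

/-- The vector norm `x ↦ N (x 1ᵀ)` induced by an algebra norm `N` on square matrices. -/
def AlgebraNorm.columnSeminorm {p : ℕ} (N : AlgebraNorm ℝ (Matrix (Fin p) (Fin p) ℝ)) :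
    Seminorm ℝ (Fin p → ℝ) :=
  Seminorm.of (fun x => N (Matrix.replicateCol (Fin p) x))
    (fun x y => by rw [Matrix.replicateCol_add]; exact map_add_le_add N _ _)
    (fun a x => by rw [Matrix.replicateCol_smul]; exact map_smul_eq_mul N a _)

namespace AlgebraNorm

variable {p : ℕ} (N : AlgebraNorm ℝ (Matrix (Fin p) (Fin p) ℝ))

theorem columnSeminorm_apply (x : Fin p → ℝ) :
    N.columnSeminorm x = N (Matrix.replicateCol (Fin p) x) := rfl

/-- `N` need not be an operator norm. Multiplying the matrix whose columns all equal `x` by `B`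
applies `B` to each column, so submultiplicativity of `N` gives the compatibility. -/
theorem columnSeminorm_mulVec_le (B : Matrix (Fin p) (Fin p) ℝ) (x : Fin p → ℝ) :
    N.columnSeminorm (B *ᵥ x) ≤ N B * N.columnSeminorm x := by
  rw [columnSeminorm_apply, Matrix.replicateCol_mulVec]
  exact map_mul_le_mul N _ _

theorem columnSeminorm_pos {x : Fin p → ℝ} (hx : x ≠ 0) : 0 < N.columnSeminorm x := by
  refine lt_of_le_of_ne (apply_nonneg _ _) fun h => hx ?_
  have h := eq_zero_of_map_eq_zero N (h.symm : N (Matrix.replicateCol (Fin p) x) = 0)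
  funext i
  exact congrFun (congrFun h i) i

theorem exists_columnSeminorm_le :
    ∃ C : ℝ, 0 < C ∧ ∀ x, N.columnSeminorm x ≤ C * ‖x‖ := by
  refine ⟨∑ i, N.columnSeminorm (Pi.single i 1) + 1,
    add_pos_of_nonneg_of_pos (Finset.sum_nonneg fun i _ => apply_nonneg _ _) one_pos,
    fun x => ?_⟩
  have h : x = ∑ i, x i • (Pi.single i 1 : Fin p → ℝ) := by
    ext i; simp [Finset.sum_apply, Pi.single_apply]
  calc N.columnSeminorm x = N.columnSeminorm (∑ i, x i • (Pi.single i 1 : Fin p → ℝ)) := by rw [← h]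
    _ ≤ ∑ i, N.columnSeminorm (x i • (Pi.single i 1 : Fin p → ℝ)) :=
        Finset.le_sum_of_subadditive _ (map_zero _).le (map_add_le_add _) _ _
    _ ≤ ∑ i, N.columnSeminorm (Pi.single i 1) * ‖x‖ := Finset.sum_le_sum fun i _ => by
        rw [map_smul_eq_mul, mul_comm]
        exact mul_le_mul_of_nonneg_left (norm_le_pi_norm x i) (apply_nonneg _ _)
    _ ≤ _ := by
        rw [← Finset.sum_mul]
        exact mul_le_mul_of_nonneg_right (by simp) (norm_nonneg _)

theorem continuous_columnSeminorm : Continuous N.columnSeminorm := by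
  obtain ⟨C, hC, h⟩ := N.exists_columnSeminorm_le
  refine Seminorm.continuous_of_le (q := C.toNNReal • normSeminorm ℝ (Fin p → ℝ)) ?_ fun x => ?_
  · exact (continuous_norm.const_smul C.toNNReal)
  · simpa [NNReal.smul_def, hC.le] using h x

/-- By compactness the continuous function `columnSeminorm` attains a positive minimum on the unit
sphere. -/
theorem exists_norm_le_columnSeminorm :
    ∃ C : ℝ, 0 < C ∧ ∀ x, ‖x‖ ≤ C * N.columnSeminorm x := by
  rcases (Metric.sphere (0 : Fin p → ℝ) 1).eq_empty_or_nonempty with he | hne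
  -- An empty sphere means that the space is trivial, the case `p = 0`.
  · refine ⟨1, one_pos, fun x => ?_⟩
    have hx : x = 0 := by
      by_contra hx
      have : ‖x‖⁻¹ • x ∈ Metric.sphere (0 : Fin p → ℝ) 1 := by
        simp [norm_smul, norm_ne_zero_iff.2 hx]
      simp [he] at this
    simp [hx]
  · obtain ⟨x₀, hx₀, hmin⟩ := (isCompact_sphere (0 : Fin p → ℝ) 1).exists_isMinOn hne
      N.continuous_columnSeminorm.continuousOn
    have hx₀' : 0 < N.columnSeminorm x₀ :=
      N.columnSeminorm_pos fun h => by simp [h] at hx₀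
    refine ⟨(N.columnSeminorm x₀)⁻¹, inv_pos.2 hx₀', fun x => ?_⟩
    by_cases hx : x = 0
    · simp [hx]
    have hxn : 0 < ‖x‖ := norm_pos_iff.2 hx
    have hmem : ‖x‖⁻¹ • x ∈ Metric.sphere (0 : Fin p → ℝ) 1 := by
      simp [norm_smul, hxn.ne']
    have h : N.columnSeminorm x₀ ≤ N.columnSeminorm (‖x‖⁻¹ • x) := hmin hmem
    rw [map_smul_eq_mul, norm_inv, norm_norm, inv_mul_eq_div, le_div_iff₀ hxn] at h
    rw [inv_mul_eq_div, le_div_iff₀ hx₀', mul_comm]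
    exact h

end AlgebraNorm

theorem SVARModel.lintegral_enorm_noise_ne_top {p r : ℕ} (M : SVARModel p r) (j : Fin r)
    (S : Matrix (Fin p) (Fin p) ℝ) : ∫⁻ e, ‖S *ᵥ e‖ₑ ∂(M.ν j) ≠ ∞ := by
  have := M.noise_prob j
  have h₁ : Integrable (fun e : Fin p → ℝ => e) (M.ν j) :=
    Integrable.of_eval fun a => (M.noise_memLp j a).integrable one_le_two
  have h₂ := (Matrix.mulVecLin S).toContinuousLinearMap.integrable_comp h₁
  exact h₂.2.ne

/-- A negative mean logarithmic norm provides a contracting weight. -/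
theorem SVARModel.exists_isContractingWeight {p r : ℕ} (M : SVARModel p r)
    (ρ : Fin r → ℝ) (hρ : IsStationaryDistribution M.T ρ)
    (N : AlgebraNorm ℝ (Matrix (Fin p) (Fin p) ℝ)) (hCB : M.expectLogNorm N ρ < 0) :
    ∃ D c h θ C s, M.IsContractingWeight D c h θ C s := by
  obtain ⟨k, hk⟩ := M.irreducible.exists_pow_pos_of_isAperiodic M.aperiodic
  obtain ⟨b, hb, hNb, hlog⟩ := exists_pos_bound_of_sum_log_neg (hρ.pos hk)
    (fun i => apply_nonneg N (M.B i)) hCB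
  obtain ⟨s, θ, h, hs0, hs1, hθ0, hθ1, hh, hdrift⟩ :=
    hρ.exists_rpow_contraction M.stochastic hk hb hlog
  -- The drift inequality is homogeneous in `h`, so `h` can be rescaled to be at least `1`.
  obtain ⟨η, hη0, hη⟩ : ∃ η : ℝ, 0 < η ∧ ∀ i, 1 ≤ η * h i := by
    refine ⟨∑ i, (h i)⁻¹ + 1, add_pos_of_nonneg_of_pos
      (Finset.sum_nonneg fun i _ => (inv_pos.2 (hh i)).le) one_pos, fun i => ?_⟩
    refine (inv_mul_cancel₀ (hh i).ne').symm.le.trans (mul_le_mul_of_nonneg_right ?_ (hh i).le)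
    have := Finset.single_le_sum (f := fun i => (h i)⁻¹) (fun i _ => (inv_pos.2 (hh i)).le)
      (Finset.mem_univ i)
    linarith
  obtain ⟨C₁, hC₁, hle⟩ := N.exists_columnSeminorm_le
  obtain ⟨C₂, hC₂, hge⟩ := N.exists_norm_le_columnSeminorm
  set q := N.columnSeminorm
  have hq : ∀ x, 0 ≤ q x := fun x => apply_nonneg q x
  refine ⟨fun x => ENNReal.ofReal (q x ^ s), fun j => ENNReal.ofReal (b j ^ s),
    fun j => ENNReal.ofReal (η * h j), ENNReal.ofReal θ, ENNReal.ofReal (C₂ ^ s), s,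
    ⟨?_, ?_, fun _ => ENNReal.ofReal_ne_top, fun x y => ?_, fun x => ?_, fun j x => ?_, fun j => ?_,
      fun i => ?_, fun _ => ENNReal.ofReal_ne_top, fun i => ?_, ?_, hs0, hs1,
      ENNReal.ofReal_ne_top, fun x => ?_⟩⟩
  · exact (N.continuous_columnSeminorm.measurable.pow_const s).ennreal_ofReal
  · simp [map_zero, Real.zero_rpow hs0.ne']
  · rw [← ENNReal.ofReal_add (Real.rpow_nonneg (hq x) s) (Real.rpow_nonneg (hq y) s)]
    refine ENNReal.ofReal_le_ofReal ?_
    exact (Real.rpow_le_rpow (hq _) (map_add_le_add q x y) hs0.le).trans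
      (Real.rpow_add_le_add_rpow (hq x) (hq y) hs0.le hs1)
  · rw [map_neg_eq_map]
  · rw [← ENNReal.ofReal_mul (Real.rpow_nonneg (hb j).le s), ← Real.mul_rpow (hb j).le (hq x)]
    refine ENNReal.ofReal_le_ofReal (Real.rpow_le_rpow (hq _) ?_ hs0.le)
    exact (N.columnSeminorm_mulVec_le _ _).trans (mul_le_mul_of_nonneg_right (hNb j) (hq x))
  · have := M.noise_prob j
    -- Since `s ≤ 1`, `q ^ s ≤ 1 + q`, and a first moment of the noise suffices.
    have hbound : ∀ x, ENNReal.ofReal (q x ^ s) ≤ 1 + ENNReal.ofReal C₁ * ‖x‖ₑ := fun x => by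
      rw [← ofReal_norm, ← ENNReal.ofReal_mul hC₁.le, ← ENNReal.ofReal_one,
        ← ENNReal.ofReal_add zero_le_one (by positivity)]
      refine ENNReal.ofReal_le_ofReal ?_
      rcases le_total (q x) 1 with h1 | h1
      · exact (Real.rpow_le_one (hq x) h1 hs0.le).trans (le_add_of_nonneg_right (by positivity))
      · have := Real.rpow_le_rpow_of_exponent_le h1 hs1
        rw [Real.rpow_one] at this
        linarith [hle x]
    refine ne_top_of_le_ne_top ?_ (lintegral_mono fun e => hbound (M.S j *ᵥ e))
    rw [lintegral_add_left measurable_const, lintegral_const_mul' _ _ ENNReal.ofReal_ne_top]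
    refine ENNReal.add_ne_top.2 ⟨by simp, ENNReal.mul_ne_top ENNReal.ofReal_ne_top ?_⟩
    exact M.lintegral_enorm_noise_ne_top j (M.S j)
  · exact ENNReal.one_le_ofReal.2 (hη i)
  · have hT : ∀ j, 0 ≤ M.T i j := fun j => nonneg_of_mem_rowStochastic M.stochastic
    have hbs : ∀ j, 0 ≤ b j ^ s := fun j => Real.rpow_nonneg (hb j).le s
    have hηh : ∀ j, 0 ≤ η * h j := fun j => zero_le_one.trans (hη j)
    simp_rw [← ENNReal.ofReal_mul (hbs _), ← ENNReal.ofReal_mul (hT _)]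
    rw [← ENNReal.ofReal_sum_of_nonneg fun j _ => mul_nonneg (hT j) (mul_nonneg (hbs j) (hηh j)),
      ← ENNReal.ofReal_mul hθ0.le]
    refine ENNReal.ofReal_le_ofReal ?_
    have := mul_le_mul_of_nonneg_left (hdrift i) hη0.le
    rw [Finset.mul_sum] at this
    calc _ = ∑ j, η * (M.T i j * (b j ^ s * h j)) := Finset.sum_congr rfl fun j _ => by ring
      _ ≤ _ := this
      _ = _ := by ring
  · simpa using hθ1
  · rw [← ofReal_norm, ENNReal.ofReal_rpow_of_nonneg (norm_nonneg _) hs0.le,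
      ← ENNReal.ofReal_mul (Real.rpow_nonneg hC₂.le s), ← Real.mul_rpow hC₂.le (hq x)]
    exact ENNReal.ofReal_le_ofReal (Real.rpow_le_rpow (norm_nonneg _) (hge x) hs0.le)

/-! ### Integration over independent variables and along the regime chain. -/

theorem ProbabilityTheory.IndepFun.lintegral_prodMk {Ω α β : Type*} [MeasurableSpace Ω]
    [MeasurableSpace α] [MeasurableSpace β] {P : Measure Ω} [IsProbabilityMeasure P]
    {f : Ω → α} {g : Ω → β} (h : IndepFun f g P) (hf : Measurable f) (hg : Measurable g)
    {Φ : α → β → ℝ≥0∞} (hΦ : Measurable (Function.uncurry Φ)) :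
    ∫⁻ ω, Φ (f ω) (g ω) ∂P = ∫⁻ ω, ∫⁻ ω', Φ (f ω) (g ω') ∂P ∂P := by
  have := Measure.isProbabilityMeasure_map (μ := P) hf.aemeasurable
  have := Measure.isProbabilityMeasure_map (μ := P) hg.aemeasurable
  calc ∫⁻ ω, Φ (f ω) (g ω) ∂P
      = ∫⁻ z, Function.uncurry Φ z ∂(P.map fun ω => (f ω, g ω)) :=
        (lintegral_map hΦ (hf.prodMk hg)).symm
    _ = ∫⁻ x, ∫⁻ y, Φ x y ∂(P.map g) ∂(P.map f) := by
        rw [h.map_prod_eq_prod_map_map hf.aemeasurable hg.aemeasurable, lintegral_prod _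
          hΦ.aemeasurable]
        rfl
    _ = _ := by
        rw [lintegral_map (f := fun x => ∫⁻ y, Φ x y ∂(P.map g)) hΦ.lintegral_prod_right' hf]
        exact lintegral_congr fun ω => lintegral_map (hΦ.comp measurable_prodMk_left) hg

/-- In an independent family indexed by time and regime, a function of the variables up to time
`n` is independent of each variable at time `n + 1`. -/
theorem ProbabilityTheory.iIndepFun.indepFun_of_congr_le {r : ℕ} {Ω α β : Type*}
    [MeasurableSpace Ω] [MeasurableSpace α] [MeasurableSpace β] [Nonempty α] {P : Measure Ω}
    {f : ℕ × Fin r → Ω → α} (hf : iIndepFun f P) (hfm : ∀ ni, Measurable (f ni))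
    {g : (ℕ × Fin r → α) → β} (hg : Measurable g) {n : ℕ}
    (hgn : ∀ v w, (∀ k ≤ n, ∀ i, v (k, i) = w (k, i)) → g v = g w) (j : Fin r) :
    IndepFun (fun ω => g fun ni => f ni ω) (f (n + 1, j)) P := by
  classical
  have h := hf.indepFun_finset (Finset.range (n + 1) ×ˢ Finset.univ) {(n + 1, j)} (by simp) hfm
  -- Extends finitely many coordinates to a full array. The filler values are irrelevant, as `g`
  -- only sees times up to `n`.
  set ext : ((Finset.range (n + 1) ×ˢ (Finset.univ : Finset (Fin r)) : Finset (ℕ × Fin r)) →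
      α) → ℕ × Fin r → α := fun v ni => if hni : ni ∈
        Finset.range (n + 1) ×ˢ (Finset.univ : Finset (Fin r)) then v ⟨ni, hni⟩
          else Classical.arbitrary α with hext
  have hextm : Measurable ext := by
    refine measurable_pi_lambda _ fun ni => ?_
    by_cases hni : ni ∈ Finset.range (n + 1) ×ˢ (Finset.univ : Finset (Fin r))
    · simpa only [hext, hni, dite_true] using measurable_pi_apply _
    · simp only [hext, hni, dite_false]
      exact measurable_const
  have h₁ : Measurable fun v : (({(n + 1, j)} : Finset (ℕ × Fin r)) → α) =>
      v ⟨(n + 1, j), by simp⟩ := measurable_pi_apply _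
  have h₂ := h.comp (hg.comp hextm) h₁
  refine h₂.congr (ae_of_all _ fun ω => hgn _ _ fun k hk i => ?_) (ae_of_all _ fun ω => rfl)
  simp [hext, hk.not_gt]

theorem lintegral_comp_fintype {Ω α : Type*} [MeasurableSpace Ω] [Fintype α]
    [MeasurableSpace α] [MeasurableSingletonClass α] (P : Measure Ω) {F : Ω → α}
    (hF : Measurable F) (g : α → ℝ≥0∞) :
    ∫⁻ ω, g (F ω) ∂P = ∑ a, g a * P {ω | F ω = a} := by
  rw [← lintegral_map (measurable_of_countable g) hF, lintegral_fintype]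
  refine Finset.sum_congr rfl fun a _ => ?_
  rw [Measure.map_apply hF (measurableSet_singleton a)]
  rfl

namespace IsMarkovChain

variable {r : ℕ} {Ω : Type*} [MeasurableSpace Ω] {P : Measure Ω} [IsProbabilityMeasure P]
  {T : Matrix (Fin r) (Fin r) ℝ} {I : ℕ → Ω → Fin r}

/-- The Markov property, integrated against a function of the path up to time `n`. -/
theorem lintegral_succ (hI : IsMarkovChain P T I) (n : ℕ)
    {H : (ℕ → Fin r) → Fin r → ℝ≥0∞} (hH : ∀ s t, (∀ k ≤ n, s k = t k) → H s = H t) :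
    ∫⁻ ω, H (fun k => I k ω) (I (n + 1) ω) ∂P =
      ∫⁻ ω, ∑ j, ENNReal.ofReal (T (I n ω) j) * H (fun k => I k ω) j ∂P := by
  set F : Ω → Fin (n + 1) → Fin r := fun ω k => I k ω with hFdef
  have hF : Measurable F := measurable_pi_lambda _ fun k => hI.measurable k
  set ext : (Fin (n + 1) → Fin r) → ℕ → Fin r :=
    fun v k => if hk : k < n + 1 then v ⟨k, hk⟩ else v 0 with hext
  have hHF : ∀ ω, H (fun k => I k ω) = H (ext (F ω)) := fun ω =>
    hH _ _ fun k hk => by simp [hext, hFdef, hk.not_gt]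
  have hmark : ∀ v j, P {ω | (F ω, I (n + 1) ω) = (v, j)} =
      P {ω | F ω = v} * ENNReal.ofReal (T (v (Fin.last n)) j) := fun v j => by
    -- The path follows `v` up to time `n` and takes the value `j` at time `n + 1`.
    have h := hI.markov n fun k => if hk : k < n + 1 then v ⟨k, hk⟩ else j
    have h₁ : {ω | ∀ k ≤ n + 1, I k ω = if hk : k < n + 1 then v ⟨k, hk⟩ else j} =
        {ω | (F ω, I (n + 1) ω) = (v, j)} := by
      ext ω
      simp only [Set.mem_ofPred_eq, Prod.mk.injEq]
      refine ⟨fun h => ⟨funext fun k => ?_, ?_⟩, fun ⟨h₁, h₂⟩ k hk => ?_⟩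
      · simpa [k.is_lt] using h k (by omega)
      · simpa using h (n + 1) le_rfl
      · rcases Nat.lt_or_eq_of_le hk with hk | rfl
        · simp [hk, ← h₁, hFdef]
        · simpa using h₂
    have h₂ : {ω | ∀ k ≤ n, I k ω = if hk : k < n + 1 then v ⟨k, hk⟩ else j} =
        {ω | F ω = v} := by
      ext ω
      simp only [Set.mem_ofPred_eq]
      refine ⟨fun h => funext fun k => ?_, fun h k hk => ?_⟩
      · simpa [k.is_lt] using h k (by omega)
      · simp [Nat.lt_succ_of_le hk, ← h, hFdef]
    rw [h₁, h₂] at h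
    rw [← ofReal_measureReal, h, ENNReal.ofReal_mul measureReal_nonneg, ofReal_measureReal]
    simp [Fin.last]
  calc ∫⁻ ω, H (fun k => I k ω) (I (n + 1) ω) ∂P
      = ∫⁻ ω, (fun z : (Fin (n + 1) → Fin r) × Fin r => H (ext z.1) z.2)
          (F ω, I (n + 1) ω) ∂P := lintegral_congr fun ω => by rw [hHF]
    _ = ∑ v, ∑ j, H (ext v) j * (P {ω | F ω = v} * ENNReal.ofReal (T (v (Fin.last n)) j)) := by
        refine (lintegral_comp_fintype P (hF.prodMk (hI.measurable (n + 1)))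
          (fun z : (Fin (n + 1) → Fin r) × Fin r => H (ext z.1) z.2)).trans ?_
        rw [Fintype.sum_prod_type]
        simp only [hmark]
    _ = ∑ v, (∑ j, ENNReal.ofReal (T (v (Fin.last n)) j) * H (ext v) j) * P {ω | F ω = v} := by
        refine Finset.sum_congr rfl fun v _ => ?_
        rw [Finset.sum_mul]
        exact Finset.sum_congr rfl fun j _ => by ring
    _ = ∫⁻ ω, (fun v => ∑ j, ENNReal.ofReal (T (v (Fin.last n)) j) * H (ext v) j) (F ω) ∂P :=
        (lintegral_comp_fintype P hF _).symm
    _ = _ := lintegral_congr fun ω => by simp only [hHF]; rfl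

theorem lintegral_comp_eq (hI : IsMarkovChain P T I) (hT : T ∈ rowStochastic ℝ (Fin r))
    (n : ℕ) {f : Fin r → ℝ} (hf : ∀ i, 0 ≤ f i) :
    ∫⁻ ω, ENNReal.ofReal (f (I n ω)) ∂P = ∫⁻ ω, ENNReal.ofReal ((T ^ n *ᵥ f) (I 0 ω)) ∂P := by
  induction n generalizing f with
  | zero => simp
  | succ n ih =>
    rw [hI.lintegral_succ n (H := fun _ j => ENNReal.ofReal (f j)) fun _ _ _ => rfl,
      pow_succ, ← Matrix.mulVec_mulVec, ← ih (nonneg_mulVec_of_mem_rowStochastic hT hf)]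
    refine lintegral_congr fun ω => ?_
    have hnn : ∀ j, 0 ≤ T (I n ω) j := fun j => nonneg_of_mem_rowStochastic hT
    simp_rw [← ENNReal.ofReal_mul (hnn _)]
    rw [← ENNReal.ofReal_sum_of_nonneg fun j _ => mul_nonneg (hnn j) (hf j)]
    rfl

theorem tendsto_lintegral_comp (hI : IsMarkovChain P T I) (hT : T ∈ rowStochastic ℝ (Fin r))
    {ρ : Fin r → ℝ} (hρ : IsStationaryDistribution T ρ) {k : ℕ} (hk : ∀ i j, 0 < (T ^ k) i j)
    {g : Fin r → ℝ≥0∞} (hg : ∀ i, g i ≠ ∞) :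
    Tendsto (fun n => ∫⁻ ω, g (I n ω) ∂P) atTop (𝓝 (∑ i, ENNReal.ofReal (ρ i) * g i)) := by
  have hg' : ∀ i, g i = ENNReal.ofReal (g i).toReal := fun i => (ENNReal.ofReal_toReal (hg i)).symm
  have hlim : ∑ i, ENNReal.ofReal (ρ i) * g i =
      ∑ i, ENNReal.ofReal (ρ ⬝ᵥ fun i => (g i).toReal) * P {ω | I 0 ω = i} := by
    have h := lintegral_comp_fintype P (hI.measurable 0)
      fun _ => ENNReal.ofReal (ρ ⬝ᵥ fun i => (g i).toReal)
    rw [← h, lintegral_const, measure_univ, mul_one, dotProduct, ENNReal.ofReal_sum_of_nonneg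
      fun i _ => mul_nonneg (hρ.nonneg i) ENNReal.toReal_nonneg]
    refine Finset.sum_congr rfl fun i _ => ?_
    rw [ENNReal.ofReal_mul (hρ.nonneg i), ← hg']
  have heq : ∀ n, ∫⁻ ω, g (I n ω) ∂P =
      ∑ i, ENNReal.ofReal ((T ^ n *ᵥ fun i => (g i).toReal) i) * P {ω | I 0 ω = i} := fun n => by
    rw [← lintegral_comp_fintype P (hI.measurable 0), ← hI.lintegral_comp_eq hT n
      fun i => ENNReal.toReal_nonneg]
    simp only [← hg']
  simp only [heq, hlim]
  refine tendsto_finsetSum _ fun i _ => ?_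
  exact ENNReal.Tendsto.mul_const (ENNReal.tendsto_ofReal (hρ.tendsto_pow_mulVec hT hk _ i))
    (Or.inr (measure_ne_top _ _))

end IsMarkovChain

/-! ### The transition operator and the process started from zero. -/

namespace SVARModel

variable {p r : ℕ} (M : SVARModel p r)

/-- The transition operator of the Markov chain `(Iₙ, Xₙ)`. -/
noncomputable def transition (ψ : Fin r → (Fin p → ℝ) → ℝ≥0∞) (i : Fin r) (x : Fin p → ℝ) : ℝ≥0∞ :=
  ∑ j, ENNReal.ofReal (M.T i j) * ∫⁻ e, ψ j (M.B j *ᵥ x + M.S j *ᵥ e) ∂(M.ν j)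

/-- The value at time `n` of the process started from `0`, as a function of the path of the
regime chain and of the noises. -/
noncomputable def zeroStart (s : ℕ → Fin r) (e : ℕ × Fin r → Fin p → ℝ) : ℕ → Fin p → ℝ
  | 0 => 0
  | n + 1 => M.B (s (n + 1)) *ᵥ zeroStart s e n + M.S (s (n + 1)) *ᵥ e (n + 1, s (n + 1))

theorem zeroStart_congr {s t : ℕ → Fin r} {e f : ℕ × Fin r → Fin p → ℝ} {n : ℕ}
    (hst : ∀ k ≤ n, s k = t k) (hef : ∀ k ≤ n, ∀ i, e (k, i) = f (k, i)) :
    M.zeroStart s e n = M.zeroStart t f n := by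
  induction n with
  | zero => rfl
  | succ n ih =>
    simp only [zeroStart, hst (n + 1) le_rfl, hef (n + 1) le_rfl]
    rw [ih (fun k hk => hst k (by omega)) fun k hk => hef k (by omega)]

theorem measurable_zeroStart (n : ℕ) :
    Measurable fun z : (ℕ → Fin r) × (ℕ × Fin r → Fin p → ℝ) => M.zeroStart z.1 z.2 n := by
  induction n with
  | zero => exact measurable_const
  | succ n ih =>
    have h : Measurable fun z : Fin r × ((Fin p → ℝ) × (ℕ × Fin r → Fin p → ℝ)) =>
        M.B z.1 *ᵥ z.2.1 + M.S z.1 *ᵥ z.2.2 (n + 1, z.1) := by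
      refine measurable_from_prod_countable_right fun i => ?_
      have h₁ : ∀ A : Matrix (Fin p) (Fin p) ℝ, Measurable fun x : Fin p → ℝ => A *ᵥ x :=
        fun A => (Continuous.matrix_mulVec continuous_const continuous_id).measurable
      have h₂ : Measurable fun z : (Fin p → ℝ) × (ℕ × Fin r → Fin p → ℝ) => z.2 (n + 1, i) :=
        (measurable_pi_apply (n + 1, i)).comp measurable_snd
      exact ((h₁ (M.B i)).comp measurable_fst).add ((h₁ (M.S i)).comp h₂)
    exact h.comp (((measurable_pi_apply (n + 1)).comp measurable_fst).prodMk
      (ih.prodMk measurable_snd))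

theorem measurable_lintegral_noise {g : (Fin p → ℝ) → ℝ≥0∞} (hg : Measurable g) (j : Fin r) :
    Measurable fun x => ∫⁻ e, g (M.B j *ᵥ x + M.S j *ᵥ e) ∂(M.ν j) := by
  have := M.noise_prob j
  have h : Measurable fun z : (Fin p → ℝ) × (Fin p → ℝ) => M.B j *ᵥ z.1 + M.S j *ᵥ z.2 :=
    (Continuous.add (Continuous.matrix_mulVec continuous_const continuous_fst)
      (Continuous.matrix_mulVec continuous_const continuous_snd)).measurable
  exact (hg.comp h).lintegral_prod_right'

theorem measurable_transition {ψ : Fin r → (Fin p → ℝ) → ℝ≥0∞} (hψ : ∀ j, Measurable (ψ j))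
    (i : Fin r) : Measurable (M.transition ψ i) :=
  Finset.measurable_fun_sum _ fun j _ => (M.measurable_lintegral_noise (hψ j) j).const_mul _

theorem sum_ofReal_T (i : Fin r) : ∑ j, ENNReal.ofReal (M.T i j) = 1 := by
  rw [← ENNReal.ofReal_sum_of_nonneg fun j _ => nonneg_of_mem_rowStochastic M.stochastic,
    sum_row_of_mem_rowStochastic M.stochastic, ENNReal.ofReal_one]

theorem transition_le {ψ : Fin r → (Fin p → ℝ) → ℝ≥0∞} {b : ℝ≥0∞} (hψ : ∀ j x, ψ j x ≤ b)
    (i : Fin r) (x : Fin p → ℝ) : M.transition ψ i x ≤ b := by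
  calc M.transition ψ i x ≤ ∑ j, ENNReal.ofReal (M.T i j) * b := by
        refine Finset.sum_le_sum fun j _ => mul_le_mul_right ?_ _
        have := M.noise_prob j
        exact (lintegral_mono fun e => hψ j _).trans (by simp)
    _ = b := by rw [← Finset.sum_mul, M.sum_ofReal_T, one_mul]

theorem iterate_transition_le {ψ : Fin r → (Fin p → ℝ) → ℝ≥0∞} {b : ℝ≥0∞}
    (hψ : ∀ j x, ψ j x ≤ b) (n : ℕ) (i : Fin r) (x : Fin p → ℝ) :
    M.transition^[n] ψ i x ≤ b := by
  induction n generalizing i x with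
  | zero => exact hψ i x
  | succ n ih =>
    rw [Function.iterate_succ_apply']
    exact M.transition_le ih i x

variable {M}

namespace IsSVAR

variable {Ω : Type*} [MeasurableSpace Ω] {P : Measure Ω}
  {I : ℕ → Ω → Fin r} {ε : ℕ → Fin r → Ω → Fin p → ℝ} {X : ℕ → Ω → Fin p → ℝ}

theorem measurable_chain (hX : M.IsSVAR P I ε X) : Measurable fun ω n => I n ω :=
  measurable_pi_lambda _ hX.chain.measurable

theorem measurable_noise (hX : M.IsSVAR P I ε X) :
    Measurable fun ω (ni : ℕ × Fin r) => ε ni.1 ni.2 ω :=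
  measurable_pi_lambda _ fun ni => hX.noise_measurable ni.1 ni.2

/-- With the regime path frozen, the value at time `n` involves only noises up to time `n`. -/
theorem indepFun_zeroStart (hX : M.IsSVAR P I ε X) (s : ℕ → Fin r) (n : ℕ) (j : Fin r) :
    IndepFun (fun ω => M.zeroStart s (fun ni => ε ni.1 ni.2 ω) n) (ε (n + 1) j) P :=
  hX.noise_indep.indepFun_of_congr_le (fun ni => hX.noise_measurable ni.1 ni.2)
    (g := fun e => M.zeroStart s e n)
    ((M.measurable_zeroStart n).comp (measurable_const.prodMk measurable_id))
    (fun _ _ h => M.zeroStart_congr (fun _ _ => rfl) h) j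

variable [IsProbabilityMeasure P]

/-- The Markov property of `(Iₙ, Yₙ)`, obtained by alternating two conditionings: with the regime
path fixed, the noise of time `n + 1` is integrated out; with the noises fixed, the next regime is
averaged by the Markov property of `I`. -/
theorem lintegral_zeroStart_succ (hX : M.IsSVAR P I ε X) (n : ℕ)
    {ψ : Fin r → (Fin p → ℝ) → ℝ≥0∞} (hψ : ∀ j, Measurable (ψ j)) :
    ∫⁻ ω, ψ (I (n + 1) ω)
        (M.zeroStart (fun k => I k ω) (fun ni => ε ni.1 ni.2 ω) (n + 1)) ∂P =
      ∫⁻ ω, M.transition ψ (I n ω)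
        (M.zeroStart (fun k => I k ω) (fun ni => ε ni.1 ni.2 ω) n) ∂P := by
  have hψ' : Measurable (Function.uncurry ψ) := measurable_from_prod_countable_right hψ
  set g : Fin r → (Fin p → ℝ) → ℝ≥0∞ := fun j x =>
    ∫⁻ e, ψ j (M.B j *ᵥ x + M.S j *ᵥ e) ∂(M.ν j) with hg
  have hgm : Measurable (Function.uncurry g) :=
    measurable_from_prod_countable_right fun j => M.measurable_lintegral_noise (hψ j) j
  have htm : Measurable (Function.uncurry (M.transition ψ)) :=
    measurable_from_prod_countable_right fun j => M.measurable_transition hψ j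
  have hm₁ : ∀ k, Measurable fun z : (ℕ → Fin r) × (ℕ × Fin r → Fin p → ℝ) => z.1 k :=
    fun k => (measurable_pi_apply k).comp measurable_fst
  have hinner : ∀ s : ℕ → Fin r,
      ∫⁻ ω, ψ (s (n + 1)) (M.zeroStart s (fun ni => ε ni.1 ni.2 ω) (n + 1)) ∂P =
        ∫⁻ ω, g (s (n + 1)) (M.zeroStart s (fun ni => ε ni.1 ni.2 ω) n) ∂P := fun s => by
    have hm : Measurable (Function.uncurry fun x e : Fin p → ℝ =>
        ψ (s (n + 1)) (M.B (s (n + 1)) *ᵥ x + M.S (s (n + 1)) *ᵥ e)) :=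
      (hψ _).comp (Continuous.add (Continuous.matrix_mulVec continuous_const continuous_fst)
        (Continuous.matrix_mulVec continuous_const continuous_snd)).measurable
    have h := (hX.indepFun_zeroStart s n (s (n + 1))).lintegral_prodMk
      ((M.measurable_zeroStart n).comp (measurable_const.prodMk hX.measurable_noise))
      (hX.noise_measurable _ _) hm
    refine h.trans (lintegral_congr fun ω => ?_)
    simp only [hg]
    rw [← hX.noise_law (n + 1) (s (n + 1))]
    exact (lintegral_map (hm.comp measurable_prodMk_left) (hX.noise_measurable _ _)).symm
  calc _ = ∫⁻ ω, ∫⁻ ω', ψ (I (n + 1) ω)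
        (M.zeroStart (fun k => I k ω) (fun ni => ε ni.1 ni.2 ω') (n + 1)) ∂P ∂P :=
        hX.chain_indep_noise.lintegral_prodMk (Φ := fun s e => ψ (s (n + 1))
          (M.zeroStart s e (n + 1))) hX.measurable_chain hX.measurable_noise
          (hψ'.comp ((hm₁ (n + 1)).prodMk (M.measurable_zeroStart (n + 1))))
    _ = ∫⁻ ω, ∫⁻ ω', g (I (n + 1) ω)
        (M.zeroStart (fun k => I k ω) (fun ni => ε ni.1 ni.2 ω') n) ∂P ∂P :=
        lintegral_congr fun ω => hinner fun k => I k ω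
    _ = ∫⁻ ω, g (I (n + 1) ω)
        (M.zeroStart (fun k => I k ω) (fun ni => ε ni.1 ni.2 ω) n) ∂P :=
        (hX.chain_indep_noise.lintegral_prodMk (Φ := fun s e => g (s (n + 1))
          (M.zeroStart s e n)) hX.measurable_chain hX.measurable_noise
          (hgm.comp ((hm₁ (n + 1)).prodMk (M.measurable_zeroStart n)))).symm
    -- The order of integration is exchanged, so that the noises are now frozen and the regimes
    -- random.
    _ = ∫⁻ ω', ∫⁻ ω, g (I (n + 1) ω)
        (M.zeroStart (fun k => I k ω) (fun ni => ε ni.1 ni.2 ω') n) ∂P ∂P :=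
        hX.chain_indep_noise.symm.lintegral_prodMk (Φ := fun e s => g (s (n + 1))
          (M.zeroStart s e n)) hX.measurable_noise hX.measurable_chain
          ((hgm.comp ((hm₁ (n + 1)).prodMk (M.measurable_zeroStart n))).comp measurable_swap)
    _ = ∫⁻ ω', ∫⁻ ω, M.transition ψ (I n ω)
        (M.zeroStart (fun k => I k ω) (fun ni => ε ni.1 ni.2 ω') n) ∂P ∂P :=
        lintegral_congr fun ω' => hX.chain.lintegral_succ n
          (H := fun s j => g j (M.zeroStart s (fun ni => ε ni.1 ni.2 ω') n)) fun s t hst =>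
            funext fun j => by rw [M.zeroStart_congr hst fun _ _ _ => rfl]
    _ = _ := (hX.chain_indep_noise.symm.lintegral_prodMk (Φ := fun e s => M.transition ψ (s n)
          (M.zeroStart s e n)) hX.measurable_noise hX.measurable_chain
          ((htm.comp ((hm₁ n).prodMk (M.measurable_zeroStart n))).comp measurable_swap)).symm

theorem lintegral_zeroStart_add (hX : M.IsSVAR P I ε X) (m n : ℕ)
    {ψ : Fin r → (Fin p → ℝ) → ℝ≥0∞} (hψ : ∀ j, Measurable (ψ j)) :
    ∫⁻ ω, ψ (I (m + n) ω)
        (M.zeroStart (fun k => I k ω) (fun ni => ε ni.1 ni.2 ω) (m + n)) ∂P =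
      ∫⁻ ω, M.transition^[n] ψ (I m ω)
        (M.zeroStart (fun k => I k ω) (fun ni => ε ni.1 ni.2 ω) m) ∂P := by
  induction n generalizing ψ with
  | zero => rfl
  | succ n ih =>
    rw [← add_assoc, hX.lintegral_zeroStart_succ (m + n) hψ, ih (M.measurable_transition hψ)]
    rfl

end IsSVAR

end SVARModel

/-! ### Convergence of the process started from zero. -/

/-- The chain `limsup u ≤ liminf a ≤ limsup a ≤ liminf u` closes up. Writing the limit as `liminf a`
makes it depend on `a` alone, without assuming that `a` converges. -/
theorem ENNReal.tendsto_liminf_of_approx {u a δ : ℕ → ℝ≥0∞} (hδ : Tendsto δ atTop (𝓝 0))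
    (hup : ∀ n, limsup u atTop ≤ a n + δ n) (hlow : ∀ n, a n ≤ liminf u atTop + δ n) :
    Tendsto u atTop (𝓝 (liminf a atTop)) := by
  refine tendsto_of_le_liminf_of_limsup_le ?_ ?_
  · refine ENNReal.le_of_forall_pos_le_add fun η hη _ => ?_
    have h : limsup a atTop ≤ liminf u atTop + η := by
      refine limsup_le_of_le (by isBoundedDefault) ?_
      filter_upwards [hδ.eventually_le_const (ENNReal.coe_pos.2 hη)] with n hn
      exact (hlow n).trans (by gcongr)
    exact (Filter.liminf_le_limsup (f := atTop) (u := a)).trans h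
  · refine ENNReal.le_of_forall_pos_le_add fun η hη _ => ?_
    refine tsub_le_iff_right.1 (le_liminf_of_le (by isBoundedDefault) ?_)
    filter_upwards [hδ.eventually_le_const (ENNReal.coe_pos.2 hη)] with n hn
    exact tsub_le_iff_right.2 ((hup n).trans (by gcongr))

namespace SVARModel.IsContractingWeight

variable {p r : ℕ} {M : SVARModel p r} {D : (Fin p → ℝ) → ℝ≥0∞} {c h : Fin r → ℝ≥0∞}
  {θ C : ℝ≥0∞} {s : ℝ}

/-- Synchronous coupling: the same regime and noise are used from `x` and `y`, so the noise cancels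
in the difference and the drift inequality gains a factor `θ`. -/
theorem transition_le_add (hw : M.IsContractingWeight D c h θ C s)
    {ψ : Fin r → (Fin p → ℝ) → ℝ≥0∞} {K : ℝ≥0∞}
    (hψ : ∀ i x y, ψ i x ≤ ψ i y + K * h i * D (x - y)) (i : Fin r) (x y : Fin p → ℝ) :
    M.transition ψ i x ≤ M.transition ψ i y + θ * K * h i * D (x - y) := by
  have hstep : ∀ j, ∫⁻ e, ψ j (M.B j *ᵥ x + M.S j *ᵥ e) ∂(M.ν j) ≤
      ∫⁻ e, ψ j (M.B j *ᵥ y + M.S j *ᵥ e) ∂(M.ν j) + K * (c j * h j) * D (x - y) := fun j => by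
    have := M.noise_prob j
    calc ∫⁻ e, ψ j (M.B j *ᵥ x + M.S j *ᵥ e) ∂(M.ν j)
        ≤ ∫⁻ e, (ψ j (M.B j *ᵥ y + M.S j *ᵥ e) + K * (c j * h j) * D (x - y)) ∂(M.ν j) := by
          refine lintegral_mono fun e => (hψ j _ (M.B j *ᵥ y + M.S j *ᵥ e)).trans ?_
          rw [add_sub_add_right_eq_sub, ← Matrix.mulVec_sub]
          refine add_le_add le_rfl ?_
          calc K * h j * D (M.B j *ᵥ (x - y)) ≤ K * h j * (c j * D (x - y)) := by
                gcongr
                exact hw.mulVec_le j _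
            _ = _ := by ring
      _ = _ := by rw [lintegral_add_right _ measurable_const]; simp
  calc M.transition ψ i x
      ≤ ∑ j, ENNReal.ofReal (M.T i j) * (∫⁻ e, ψ j (M.B j *ᵥ y + M.S j *ᵥ e) ∂(M.ν j) +
          K * (c j * h j) * D (x - y)) := Finset.sum_le_sum fun j _ => by gcongr; exact hstep j
    _ = M.transition ψ i y +
          K * (∑ j, ENNReal.ofReal (M.T i j) * (c j * h j)) * D (x - y) := by
        simp only [mul_add, Finset.sum_add_distrib, transition, Finset.mul_sum, Finset.sum_mul]
        congr 1
        exact Finset.sum_congr rfl fun j _ => by ring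
    _ ≤ M.transition ψ i y + K * (θ * h i) * D (x - y) := by
        gcongr
        exact hw.drift i
    _ = _ := by ring

theorem iterate_transition_le_add (hw : M.IsContractingWeight D c h θ C s)
    {ψ : Fin r → (Fin p → ℝ) → ℝ≥0∞} {K : ℝ≥0∞}
    (hψ : ∀ i x y, ψ i x ≤ ψ i y + K * h i * D (x - y)) (n : ℕ) (i : Fin r) (x y : Fin p → ℝ) :
    M.transition^[n] ψ i x ≤ M.transition^[n] ψ i y + θ ^ n * K * h i * D (x - y) := by
  induction n generalizing i x y with
  | zero => simpa using hψ i x y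
  | succ n ih =>
    rw [Function.iterate_succ_apply', pow_succ', mul_assoc θ]
    exact hw.transition_le_add ih i x y

theorem measurable_weight (hw : M.IsContractingWeight D c h θ C s) (i : Fin r) :
    Measurable fun x => h i * D x :=
  hw.measurable.const_mul _

theorem transition_weight_le (hw : M.IsContractingWeight D c h θ C s) (i : Fin r)
    (x : Fin p → ℝ) :
    M.transition (fun i x => h i * D x) i x ≤
      θ * (h i * D x) + ∑ j, h j * ∫⁻ e, D (M.S j *ᵥ e) ∂(M.ν j) := by
  have hstep : ∀ j, ∫⁻ e, h j * D (M.B j *ᵥ x + M.S j *ᵥ e) ∂(M.ν j) ≤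
      (c j * h j) * D x + h j * ∫⁻ e, D (M.S j *ᵥ e) ∂(M.ν j) := fun j => by
    have := M.noise_prob j
    calc ∫⁻ e, h j * D (M.B j *ᵥ x + M.S j *ᵥ e) ∂(M.ν j)
        ≤ ∫⁻ e, (h j * (c j * D x) + h j * D (M.S j *ᵥ e)) ∂(M.ν j) := by
          refine lintegral_mono fun e => ?_
          rw [← mul_add]
          gcongr
          exact (hw.add_le _ _).trans (by gcongr; exact hw.mulVec_le j x)
      _ = _ := by
          rw [lintegral_add_left measurable_const, lintegral_const,
            lintegral_const_mul' _ _ (hw.h_ne_top j), measure_univ, mul_one, ← mul_assoc, mul_comm (h j)]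
  calc M.transition (fun i x => h i * D x) i x
      ≤ ∑ j, ENNReal.ofReal (M.T i j) * ((c j * h j) * D x +
          h j * ∫⁻ e, D (M.S j *ᵥ e) ∂(M.ν j)) :=
        Finset.sum_le_sum fun j _ => by gcongr; exact hstep j
    _ = (∑ j, ENNReal.ofReal (M.T i j) * (c j * h j)) * D x +
          ∑ j, ENNReal.ofReal (M.T i j) * (h j * ∫⁻ e, D (M.S j *ᵥ e) ∂(M.ν j)) := by
        simp only [mul_add, Finset.sum_add_distrib, Finset.sum_mul]
        congr 1
        exact Finset.sum_congr rfl fun j _ => by ring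
    _ ≤ θ * h i * D x + ∑ j, 1 * (h j * ∫⁻ e, D (M.S j *ᵥ e) ∂(M.ν j)) := by
        gcongr
        · exact hw.drift i
        · exact ENNReal.ofReal_le_one.2 (le_one_of_mem_rowStochastic M.stochastic)
    _ = _ := by simp only [one_mul, mul_assoc]

variable {Ω : Type*} [MeasurableSpace Ω] {P : Measure Ω} [IsProbabilityMeasure P]
  {I : ℕ → Ω → Fin r} {ε : ℕ → Fin r → Ω → Fin p → ℝ} {X : ℕ → Ω → Fin p → ℝ}

/-- The moments satisfy `a (n + 1) ≤ θ * a n + K₀` with `a 0 = 0`, so they stay below the fixed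
point `K₀ / (1 - θ)`. -/
theorem exists_moment_bound (hw : M.IsContractingWeight D c h θ C s)
    (hX : M.IsSVAR P I ε X) : ∃ K : ℝ≥0∞, K ≠ ∞ ∧ ∀ n, ∫⁻ ω, h (I n ω) *
      D (M.zeroStart (fun k => I k ω) (fun ni => ε ni.1 ni.2 ω) n) ∂P ≤ K := by
  set K₀ := ∑ j, h j * ∫⁻ e, D (M.S j *ᵥ e) ∂(M.ν j) with hK₀
  have hθ : 1 - θ ≠ 0 := (tsub_pos_of_lt hw.lt_one).ne'
  have hfix : θ * (K₀ * (1 - θ)⁻¹) + K₀ = K₀ * (1 - θ)⁻¹ := by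
    calc θ * (K₀ * (1 - θ)⁻¹) + K₀ = θ * (K₀ * (1 - θ)⁻¹) + K₀ * ((1 - θ) * (1 - θ)⁻¹) := by
          rw [ENNReal.mul_inv_cancel hθ (ENNReal.sub_ne_top ENNReal.one_ne_top), mul_one]
      _ = K₀ * (1 - θ)⁻¹ * (θ + (1 - θ)) := by ring
      _ = _ := by rw [add_tsub_cancel_of_le hw.lt_one.le, mul_one]
  refine ⟨K₀ * (1 - θ)⁻¹, ENNReal.mul_ne_top ?_ (ENNReal.inv_ne_top.2 hθ), fun n => ?_⟩
  · exact ENNReal.sum_ne_top.2 fun j _ =>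
      ENNReal.mul_ne_top (hw.h_ne_top j) (hw.lintegral_noise_ne_top j)
  · induction n with
    | zero => simp [zeroStart, hw.map_zero]
    | succ n ih =>
      rw [hX.lintegral_zeroStart_succ n (ψ := fun i x => h i * D x) hw.measurable_weight, ← hfix]
      refine (lintegral_mono fun ω => hw.transition_weight_le _ _).trans ?_
      rw [lintegral_add_right _ measurable_const, lintegral_const_mul' _ _ hw.lt_one.ne_top,
        lintegral_const, measure_univ, mul_one]
      gcongr

/-- The law of `(Iₙ, Xₙ)` with `X₀ = 0` integrates a `D`-Lipschitz function to a quantity whose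
limit does not depend on the process. -/
theorem tendsto_lintegral_zeroStart (hw : M.IsContractingWeight D c h θ C s)
    (hX : M.IsSVAR P I ε X) {ρ : Fin r → ℝ} (hρ : IsStationaryDistribution M.T ρ)
    {ψ : Fin r → (Fin p → ℝ) → ℝ≥0∞} (hψm : ∀ i, Measurable (ψ i)) {K b : ℝ≥0∞} (hK : K ≠ ∞)
    (hb : b ≠ ∞) (hψb : ∀ i x, ψ i x ≤ b)
    (hψ : ∀ i x y, ψ i x ≤ ψ i y + K * h i * D (x - y)) :
    Tendsto (fun n => ∫⁻ ω, ψ (I n ω)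
      (M.zeroStart (fun k => I k ω) (fun ni => ε ni.1 ni.2 ω) n) ∂P) atTop
      (𝓝 (liminf (fun n => ∑ i, ENNReal.ofReal (ρ i) * M.transition^[n] ψ i 0) atTop)) := by
  obtain ⟨k, hk⟩ := M.irreducible.exists_pow_pos_of_isAperiodic M.aperiodic
  obtain ⟨K₁, hK₁, hmom⟩ := hw.exists_moment_bound hX
  set Y : ℕ → Ω → Fin p → ℝ :=
    fun n ω => M.zeroStart (fun k => I k ω) (fun ni => ε ni.1 ni.2 ω) n
  set u : ℕ → ℝ≥0∞ := fun n => ∫⁻ ω, ψ (I n ω) (Y n ω) ∂P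
  have hθK : ∀ n, θ ^ n * K ≠ ∞ := fun n =>
    ENNReal.mul_ne_top (ENNReal.pow_ne_top hw.lt_one.ne_top) hK
  have hlim : ∀ n, Tendsto (fun m => ∫⁻ ω, M.transition^[n] ψ (I m ω) 0 ∂P) atTop
      (𝓝 (∑ i, ENNReal.ofReal (ρ i) * M.transition^[n] ψ i 0)) := fun n =>
    hX.chain.tendsto_lintegral_comp M.stochastic hρ hk fun i =>
      ne_top_of_le_ne_top hb (M.iterate_transition_le hψb n i 0)
  have herr : ∀ m n, ∫⁻ ω, θ ^ n * K * h (I m ω) * D (Y m ω) ∂P ≤ θ ^ n * K * K₁ := fun m n => by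
    simp only [mul_assoc (θ ^ n * K)]
    rw [lintegral_const_mul' _ _ (hθK n)]
    gcongr
    exact hmom m
  have hm : ∀ m n, Measurable fun ω => θ ^ n * K * h (I m ω) * D (Y m ω) := fun m n =>
    (((measurable_of_countable h).comp (hX.chain.measurable m)).const_mul _).mul
      (hw.measurable.comp ((M.measurable_zeroStart m).comp
        (hX.measurable_chain.prodMk hX.measurable_noise)))
  have hle : ∀ m n, u (m + n) ≤
      ∫⁻ ω, M.transition^[n] ψ (I m ω) 0 ∂P + θ ^ n * K * K₁ := fun m n => by
    refine (hX.lintegral_zeroStart_add m n hψm).trans_le ?_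
    refine (lintegral_mono fun ω => hw.iterate_transition_le_add hψ n (I m ω) (Y m ω) 0).trans ?_
    simp only [sub_zero]
    rw [lintegral_add_right _ (hm m n)]
    gcongr
    exact herr m n
  have hge : ∀ m n, ∫⁻ ω, M.transition^[n] ψ (I m ω) 0 ∂P ≤
      u (m + n) + θ ^ n * K * K₁ := fun m n => by
    refine (lintegral_mono fun ω => hw.iterate_transition_le_add hψ n (I m ω) 0 (Y m ω)).trans ?_
    simp only [zero_sub, hw.map_neg]
    rw [lintegral_add_right _ (hm m n), ← hX.lintegral_zeroStart_add m n hψm]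
    gcongr
    exact herr m n
  -- For fixed `n` the limit in `m` is taken in `hle` and `hge`; shifting `u` by `n` changes neither
  -- its `limsup` nor its `liminf`.
  refine ENNReal.tendsto_liminf_of_approx (δ := fun n => θ ^ n * K * K₁) ?_ (fun n => ?_)
    fun n => ?_
  · have h₁ := ENNReal.tendsto_pow_atTop_nhds_zero_of_lt_one hw.lt_one
    have h₂ := ENNReal.Tendsto.mul_const h₁ (b := K * K₁) (Or.inr (ENNReal.mul_ne_top hK hK₁))
    simpa [mul_assoc] using h₂
  · rw [← Filter.limsup_nat_add u n, ← ((hlim n).add_const _).limsup_eq]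
    exact limsup_le_limsup (Eventually.of_forall fun m => hle m n)
  · rw [← Filter.liminf_nat_add u n, ← tsub_le_iff_right, ← (ENNReal.Tendsto.sub (hlim n)
      tendsto_const_nhds (Or.inr (ENNReal.mul_ne_top (hθK n) hK₁))).liminf_eq]
    exact liminf_le_liminf (Eventually.of_forall fun m => tsub_le_iff_right.2 (hge m n))

/-- The product of the contraction factors along the regime chain tends to zero. -/
theorem ae_tendsto_prod (hw : M.IsContractingWeight D c h θ C s) (hI : IsMarkovChain P M.T I) :
    ∀ᵐ ω ∂P, Tendsto (fun n => ∏ k ∈ Finset.range n, c (I (k + 1) ω)) atTop (𝓝 0) := by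
  have hWm : ∀ n, Measurable fun ω => ∏ k ∈ Finset.range n, c (I (k + 1) ω) := fun n =>
    Finset.measurable_fun_prod _ fun k _ =>
      (measurable_of_countable c).comp (hI.measurable (k + 1))
  -- The factor `h (I n ω)` lets the drift inequality be iterated; afterwards it is dropped, being
  -- at least `1`.
  have hbound : ∀ n, ∫⁻ ω, (∏ k ∈ Finset.range n, c (I (k + 1) ω)) * h (I n ω) ∂P ≤
      θ ^ n * ∑ i, h i := fun n => by
    induction n with
    | zero =>
      have h₁ : ∀ ω, h (I 0 ω) ≤ ∑ i, h i := fun ω =>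
        Finset.single_le_sum (fun _ _ => zero_le) (Finset.mem_univ _)
      simpa using lintegral_mono (μ := P) h₁
    | succ n ih =>
      simp only [Finset.prod_range_succ, mul_assoc]
      rw [hI.lintegral_succ n
        (H := fun s j => (∏ k ∈ Finset.range n, c (s (k + 1))) * (c j * h j)) fun s t hst => by
          funext j
          rw [Finset.prod_congr rfl fun k hk => by
            rw [hst (k + 1) (by have := Finset.mem_range.1 hk; omega)]]]
      calc _ ≤ ∫⁻ ω, θ * ((∏ k ∈ Finset.range n, c (I (k + 1) ω)) * h (I n ω)) ∂P := by
            refine lintegral_mono fun ω => ?_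
            calc _ = (∏ k ∈ Finset.range n, c (I (k + 1) ω)) *
                  ∑ j, ENNReal.ofReal (M.T (I n ω) j) * (c j * h j) := by
                  rw [Finset.mul_sum]
                  exact Finset.sum_congr rfl fun j _ => by ring
              _ ≤ (∏ k ∈ Finset.range n, c (I (k + 1) ω)) * (θ * h (I n ω)) := by
                  gcongr
                  exact hw.drift _
              _ = _ := by ring
        _ = θ * ∫⁻ ω, (∏ k ∈ Finset.range n, c (I (k + 1) ω)) * h (I n ω) ∂P :=
            lintegral_const_mul' _ _ hw.lt_one.ne_top
        _ ≤ θ * (θ ^ n * ∑ i, h i) := by gcongr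
        _ = _ := by ring
  -- The means are dominated by a geometric series, so the random series is almost surely finite and
  -- its terms tend to zero.
  have hsum : ∫⁻ ω, ∑' n, ∏ k ∈ Finset.range n, c (I (k + 1) ω) ∂P ≠ ∞ := by
    rw [lintegral_tsum fun n => (hWm n).aemeasurable]
    have h₁ : ∀ n, ∫⁻ ω, ∏ k ∈ Finset.range n, c (I (k + 1) ω) ∂P ≤ θ ^ n * ∑ i, h i := fun n =>
      (lintegral_mono fun ω => le_mul_of_one_le_right' (hw.one_le _)).trans (hbound n)
    refine ne_top_of_le_ne_top ?_ (ENNReal.tsum_le_tsum h₁)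
    rw [ENNReal.tsum_mul_right, ENNReal.tsum_geometric]
    exact ENNReal.mul_ne_top (ENNReal.inv_ne_top.2 (tsub_pos_of_lt hw.lt_one).ne')
      (ENNReal.sum_ne_top.2 fun i _ => hw.h_ne_top i)
  filter_upwards [ae_lt_top (Measurable.tsum hWm) hsum] with ω hω
  exact ENNReal.tendsto_atTop_zero_of_tsum_ne_top hω.ne

theorem tendsto_zero_of_tendsto_weight (hw : M.IsContractingWeight D c h θ C s)
    {x : ℕ → Fin p → ℝ} (hx : Tendsto (fun n => D (x n)) atTop (𝓝 0)) :
    Tendsto x atTop (𝓝 0) := by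
  rw [tendsto_zero_iff_enorm_tendsto_zero]
  have h₁ := ENNReal.Tendsto.const_mul (a := C) hx (Or.inr hw.const_ne_top)
  rw [mul_zero] at h₁
  have h₂ : Tendsto (fun n => ‖x n‖ₑ ^ s) atTop (𝓝 0) :=
    tendsto_of_tendsto_of_tendsto_of_le_of_le tendsto_const_nhds h₁ (fun n => zero_le)
      fun n => hw.rpow_le (x n)
  have h₃ := (ENNReal.continuous_rpow_const (y := s⁻¹)).tendsto 0 |>.comp h₂
  rw [ENNReal.zero_rpow_of_pos (inv_pos.2 hw.exponent_pos)] at h₃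
  simpa [Function.comp_def, ENNReal.rpow_rpow_inv hw.exponent_pos.ne'] using h₃

end SVARModel.IsContractingWeight

/-! ### Comparison with an arbitrary starting vector. -/

namespace SVARModel.IsSVAR

variable {p r : ℕ} {M : SVARModel p r} {Ω : Type*} [MeasurableSpace Ω] {P : Measure Ω}
  {I : ℕ → Ω → Fin r} {ε : ℕ → Fin r → Ω → Fin p → ℝ} {X : ℕ → Ω → Fin p → ℝ}

theorem succ_eq (hX : M.IsSVAR P I ε X) (n : ℕ) (ω : Ω) :
    X (n + 1) ω = M.B (I (n + 1) ω) *ᵥ X n ω +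
      M.S (I (n + 1) ω) *ᵥ ε (n + 1) (I (n + 1) ω) ω := by
  rw [hX.recursion n ω]
  simp [A, E]

theorem measurable_zeroStart (hX : M.IsSVAR P I ε X) (n : ℕ) :
    Measurable fun ω => M.zeroStart (fun k => I k ω) (fun ni => ε ni.1 ni.2 ω) n :=
  (M.measurable_zeroStart n).comp (hX.measurable_chain.prodMk hX.measurable_noise)

theorem measurable (hX : M.IsSVAR P I ε X) (n : ℕ) : Measurable (X n) := by
  induction n with
  | zero => exact hX.init_measurable
  | succ n ih =>
    have h : Measurable fun z : Fin r × ((Fin p → ℝ) × (Fin r → Fin p → ℝ)) =>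
        M.B z.1 *ᵥ z.2.1 + M.S z.1 *ᵥ z.2.2 z.1 := by
      refine measurable_from_prod_countable_right fun i => ?_
      have hc : Continuous fun z : (Fin p → ℝ) × (Fin r → Fin p → ℝ) => z.2 i :=
        (continuous_apply i).comp continuous_snd
      have hc' : Continuous fun z : (Fin p → ℝ) × (Fin r → Fin p → ℝ) =>
          M.B i *ᵥ z.1 + M.S i *ᵥ z.2 i :=
        Continuous.add (Continuous.matrix_mulVec continuous_const continuous_fst)
          (Continuous.matrix_mulVec continuous_const hc)
      exact hc'.measurable
    rw [funext (hX.succ_eq n)]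
    exact h.comp ((hX.chain.measurable (n + 1)).prodMk (ih.prodMk
      (measurable_pi_lambda _ fun i => hX.noise_measurable (n + 1) i)))

/-- The noises cancel in the difference. The bound is pathwise, so no independence of `X 0` is
needed. -/
theorem weight_sub_zeroStart_le (hX : M.IsSVAR P I ε X) {D : (Fin p → ℝ) → ℝ≥0∞}
    {c h : Fin r → ℝ≥0∞} {θ C : ℝ≥0∞} {s : ℝ} (hw : M.IsContractingWeight D c h θ C s)
    (n : ℕ) (ω : Ω) :
    D (X n ω - M.zeroStart (fun k => I k ω) (fun ni => ε ni.1 ni.2 ω) n) ≤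
      (∏ k ∈ Finset.range n, c (I (k + 1) ω)) * D (X 0 ω) := by
  induction n with
  | zero => simp [zeroStart]
  | succ n ih =>
    rw [hX.succ_eq, zeroStart, add_sub_add_right_eq_sub, ← Matrix.mulVec_sub,
      Finset.prod_range_succ, mul_comm _ (c _), mul_assoc]
    exact (hw.mulVec_le _ _).trans (by gcongr)

variable [IsProbabilityMeasure P]

/-- The starting vector is forgotten. -/
theorem tendstoInMeasure_sub_zeroStart (hX : M.IsSVAR P I ε X) {D : (Fin p → ℝ) → ℝ≥0∞}
    {c h : Fin r → ℝ≥0∞} {θ C : ℝ≥0∞} {s : ℝ} (hw : M.IsContractingWeight D c h θ C s) :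
    TendstoInMeasure P
      (X - fun n ω => M.zeroStart (fun k => I k ω) (fun ni => ε ni.1 ni.2 ω) n) atTop 0 := by
  refine tendstoInMeasure_of_tendsto_ae
    (fun n => ((hX.measurable n).sub (hX.measurable_zeroStart n)).aestronglyMeasurable) ?_
  filter_upwards [hw.ae_tendsto_prod hX.chain] with ω hω
  refine hw.tendsto_zero_of_tendsto_weight ?_
  have h₁ := ENNReal.Tendsto.mul_const hω (b := D (X 0 ω)) (Or.inr (hw.ne_top _))
  rw [zero_mul] at h₁
  exact tendsto_of_tendsto_of_tendsto_of_le_of_le tendsto_const_nhds h₁ (fun n => zero_le)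
    fun n => hX.weight_sub_zeroStart_le hw n ω

end SVARModel.IsSVAR

/-! ### Bounded Lipschitz test functions. -/

namespace SVARModel.IsContractingWeight

variable {p r : ℕ} {M : SVARModel p r} {D : (Fin p → ℝ) → ℝ≥0∞} {c h : Fin r → ℝ≥0∞}
  {θ C : ℝ≥0∞} {s : ℝ}

/-- A bounded Lipschitz function is `s`-Hölder: at distance `t ≤ 1` one has `t ≤ t ^ s`, and at
larger distances the oscillation `2 * b` is at most `2 * b * t ^ s`. Adding `b` makes the function
nonnegative. -/
theorem exists_lipschitz_const (hw : M.IsContractingWeight D c h θ C s) {f : (Fin p → ℝ) → ℝ}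
    {b : ℝ} (hb : ∀ x, |f x| ≤ b) {L : ℝ≥0} (hL : LipschitzWith L f) :
    ∃ K : ℝ≥0∞, K ≠ ∞ ∧ ∀ x y, ENNReal.ofReal (f x + b) ≤
      ENNReal.ofReal (f y + b) + K * D (x - y) := by
  refine ⟨(L + ENNReal.ofReal (2 * b)) * C, ENNReal.mul_ne_top
    (ENNReal.add_ne_top.2 ⟨ENNReal.coe_ne_top, ENNReal.ofReal_ne_top⟩) hw.const_ne_top,
    fun x y => ?_⟩
  have h₁ : ENNReal.ofReal (f x + b) ≤ ENNReal.ofReal (f y + b) + ENNReal.ofReal (f x - f y) := by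
    rw [show f x + b = (f y + b) + (f x - f y) by ring]
    exact ENNReal.ofReal_add_le
  have h₂ : ENNReal.ofReal (f x - f y) ≤ (L + ENNReal.ofReal (2 * b)) * ‖x - y‖ₑ ^ s := by
    rcases le_total ‖x - y‖ₑ 1 with ht | ht
    · calc ENNReal.ofReal (f x - f y) ≤ edist (f x) (f y) := by
            rw [edist_dist, Real.dist_eq]
            exact ENNReal.ofReal_le_ofReal (le_abs_self _)
        _ ≤ L * ‖x - y‖ₑ := by rw [← edist_eq_enorm_sub]; exact hL x y
        _ ≤ (L + ENNReal.ofReal (2 * b)) * ‖x - y‖ₑ ^ s := by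
            gcongr
            · exact le_self_add
            · simpa using ENNReal.rpow_le_rpow_of_exponent_ge ht hw.exponent_le_one
    · calc ENNReal.ofReal (f x - f y) ≤ ENNReal.ofReal (2 * b) * 1 := by
            rw [mul_one]
            refine ENNReal.ofReal_le_ofReal ?_
            linarith [(abs_le.1 (hb x)).2, (abs_le.1 (hb y)).1]
        _ ≤ _ := by
            gcongr
            · exact le_add_self
            · exact ENNReal.one_le_rpow ht hw.exponent_pos
  refine h₁.trans ?_
  gcongr
  refine h₂.trans ?_
  rw [mul_assoc]
  gcongr
  exact hw.rpow_le _

theorem exists_tendsto_integral_zeroStart (hw : M.IsContractingWeight D c h θ C s)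
    {ρ : Fin r → ℝ} (hρ : IsStationaryDistribution M.T ρ) {f : (Fin p → ℝ) → ℝ}
    (hf : ∃ b : ℝ, ∀ x y, dist (f x) (f y) ≤ b) (hL : ∃ L, LipschitzWith L f) :
    ∃ l : ℝ, ∀ (Ω : Type u) [MeasurableSpace Ω] (P : Measure Ω) [IsProbabilityMeasure P]
      (I : ℕ → Ω → Fin r) (ε : ℕ → Fin r → Ω → Fin p → ℝ) (X : ℕ → Ω → Fin p → ℝ),
      M.IsSVAR P I ε X → Tendsto (fun n => ∫ ω, f
        (M.zeroStart (fun k => I k ω) (fun ni => ε ni.1 ni.2 ω) n) ∂P) atTop (𝓝 l) := by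
  obtain ⟨b₀, hb₀⟩ := hf
  obtain ⟨L, hL⟩ := hL
  set b := |f 0| + b₀
  have hb : ∀ x, |f x| ≤ b := fun x => by
    have h₁ := hb₀ x 0
    rw [Real.dist_eq] at h₁
    have h₂ := abs_sub_abs_le_abs_sub (f x) (f 0)
    simp only [b]
    linarith
  obtain ⟨K, hK, hlip⟩ := hw.exists_lipschitz_const hb hL
  set ψ : Fin r → (Fin p → ℝ) → ℝ≥0∞ := fun _ x => ENNReal.ofReal (f x + b)
  have hψm : ∀ i, Measurable (ψ i) := fun _ =>
    (hL.continuous.measurable.add_const b).ennreal_ofReal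
  have hψb : ∀ i x, ψ i x ≤ ENNReal.ofReal (2 * b) := fun i x =>
    ENNReal.ofReal_le_ofReal (by linarith [(abs_le.1 (hb x)).2])
  have hψ : ∀ i x y, ψ i x ≤ ψ i y + K * h i * D (x - y) := fun i x y => by
    refine (hlip x y).trans ?_
    gcongr
    exact le_mul_of_one_le_right' (hw.one_le i)
  set l := liminf (fun n => ∑ i, ENNReal.ofReal (ρ i) * M.transition^[n] ψ i 0) atTop
  refine ⟨l.toReal - b, fun Ω _ P _ I ε X hX => ?_⟩
  have h₁ := hw.tendsto_lintegral_zeroStart hX hρ hψm hK ENNReal.ofReal_ne_top hψb hψ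
  have hl : l ≠ ∞ := ne_top_of_le_ne_top ENNReal.ofReal_ne_top (le_of_tendsto' h₁ fun n =>
    (lintegral_mono fun ω => hψb (I n ω) _).trans
      (by rw [lintegral_const, measure_univ, mul_one]))
  refine (((ENNReal.tendsto_toReal hl).comp h₁).sub_const b).congr fun n => ?_
  have hm := hL.continuous.measurable.comp (hX.measurable_zeroStart n)
  have hint : Integrable (fun ω => f
      (M.zeroStart (fun k => I k ω) (fun ni => ε ni.1 ni.2 ω) n)) P :=
    Integrable.of_bound hm.aestronglyMeasurable b (ae_of_all _ fun ω => hb _)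
  have h₂ := integral_eq_lintegral_of_nonneg_ae (μ := P) (f := fun ω => f
      (M.zeroStart (fun k => I k ω) (fun ni => ε ni.1 ni.2 ω) n) + b)
    (ae_of_all _ fun ω => by
      simp only [Pi.zero_apply]
      linarith [(abs_le.1 (hb
      (M.zeroStart (fun k => I k ω) (fun ni => ε ni.1 ni.2 ω) n))).1])
    (hm.add_const b).aestronglyMeasurable
  rw [integral_add hint (integrable_const b), integral_const, probReal_univ, one_smul] at h₂
  simp only [Function.comp_apply, ψ]
  linarith

end SVARModel.IsContractingWeight

/-! ### Existence of an SVAR process. -/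

theorem ProbabilityTheory.iIndepFun.comp_measurePreserving {ι Ω Ω' α : Type*}
    [MeasurableSpace Ω] [MeasurableSpace Ω'] [MeasurableSpace α] {P : Measure Ω}
    {P' : Measure Ω'} [IsProbabilityMeasure P] [IsProbabilityMeasure P'] {f : ι → Ω → α}
    (hf : iIndepFun f P) (hfm : ∀ i, Measurable (f i)) {φ : Ω' → Ω}
    (hφ : MeasurePreserving φ P' P) : iIndepFun (fun i ω => f i (φ ω)) P' := by
  have hfm' : ∀ i, Measurable fun ω => f i (φ ω) := fun i => (hfm i).comp hφ.measurable
  rw [iIndepFun_iff_map_fun_eq_infinitePi_map hfm']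
  have h₁ : ∀ i, P'.map (fun ω => f i (φ ω)) = P.map (f i) := fun i => by
    rw [← hφ.map_eq, Measure.map_map (hfm i) hφ.measurable]
    rfl
  simp only [h₁]
  rw [← hf.map_fun_eq_infinitePi_map hfm, ← hφ.map_eq,
    Measure.map_map (measurable_pi_lambda _ hfm) hφ.measurable]
  rfl

/-- Independent random variables with prescribed laws, on a space in a prescribed universe. -/
theorem exists_iIndepFun_map_eq {ι α : Type} [MeasurableSpace α] (μ : ι → Measure α)
    [∀ i, IsProbabilityMeasure (μ i)] :
    ∃ (Ω : Type u) (_ : MeasurableSpace Ω) (P : Measure Ω) (f : ι → Ω → α),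
      IsProbabilityMeasure P ∧ (∀ i, Measurable (f i)) ∧ (∀ i, P.map (f i) = μ i) ∧
        iIndepFun f P := by
  have : ∀ i, IsProbabilityMeasure ((μ i).map (ULift.up.{u} : α → ULift.{u} α)) := fun i =>
    Measure.isProbabilityMeasure_map measurable_up.aemeasurable
  obtain ⟨Ω, mΩ, P, X, hXm, hXl, hXi, hP⟩ := exists_hasLaw_indepFun
    (fun _ : ι => ULift.{u} α) fun i => (μ i).map ULift.up
  refine ⟨Ω, mΩ, P, fun i ω => (X i ω).down, hP, fun i => measurable_down.comp (hXm i),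
    fun i => ?_, hXi.comp (fun _ => ULift.down) fun _ => measurable_down⟩
  change P.map (ULift.down ∘ X i) = μ i
  rw [← Measure.map_map measurable_down (hXm i), (hXl i).map_eq,
    Measure.map_map measurable_down measurable_up]
  exact Measure.map_id

/-- The chain started from `i₀` which moves from `i` at time `n` to `v (n + 1, i)`. -/
def drivenChain {r : ℕ} (i₀ : Fin r) (v : ℕ × Fin r → Fin r) : ℕ → Fin r
  | 0 => i₀
  | n + 1 => v (n + 1, drivenChain i₀ v n)

theorem drivenChain_congr {r : ℕ} (i₀ : Fin r) {v w : ℕ × Fin r → Fin r} {n : ℕ}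
    (hvw : ∀ k ≤ n, ∀ i, v (k, i) = w (k, i)) : drivenChain i₀ v n = drivenChain i₀ w n := by
  induction n with
  | zero => rfl
  | succ n ih =>
    simp only [drivenChain]
    rw [ih fun k hk => hvw k (by omega), hvw (n + 1) le_rfl]

theorem measurable_drivenChain {r : ℕ} (i₀ : Fin r) (n : ℕ) :
    Measurable fun v => drivenChain i₀ v n := by
  induction n with
  | zero => exact measurable_const
  | succ n ih =>
    have h : Measurable fun z : Fin r × (ℕ × Fin r → Fin r) => z.2 (n + 1, z.1) :=
      measurable_from_prod_countable_right fun i => measurable_pi_apply (n + 1, i)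
    exact h.comp (ih.prodMk measurable_id)

theorem isMarkovChain_drivenChain {r : ℕ} {Ω : Type*} [MeasurableSpace Ω] {P : Measure Ω}
    [IsProbabilityMeasure P] {T : Matrix (Fin r) (Fin r) ℝ} (i₀ : Fin r)
    {U : ℕ × Fin r → Ω → Fin r} (hU : iIndepFun U P) (hUm : ∀ ni, Measurable (U ni))
    (hlaw : ∀ n i j, P.real (U (n, i) ⁻¹' {j}) = T i j) :
    IsMarkovChain P T fun n ω => drivenChain i₀ (fun ni => U ni ω) n where
  measurable n := (measurable_drivenChain i₀ n).comp (measurable_pi_lambda _ hUm)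
  markov n s := by
    have hg : Measurable fun v => ∀ k ≤ n, drivenChain i₀ v k = s k := by
      refine measurableSet_setOfPred.1 ?_
      have h : {v | ∀ k ≤ n, drivenChain i₀ v k = s k} =
          ⋂ k ∈ Finset.range (n + 1), (fun v => drivenChain i₀ v k) ⁻¹' {s k} := by
        ext v
        simp
      rw [h]
      exact Finset.measurableSet_biInter _ fun k _ =>
        measurable_drivenChain i₀ k (measurableSet_singleton _)
    have : Nonempty (Fin r) := ⟨i₀⟩
    -- The path up to time `n` uses only moves up to time `n`, hence is independent of the move `U
    -- (n + 1, s n)` that decides the next state.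
    have hind := hU.indepFun_of_congr_le hUm hg
      (fun v w hvw => propext (forall₂_congr fun k hk => by
        rw [drivenChain_congr i₀ fun l hl => hvw l (hl.trans hk)])) (s n)
    have h := hind.measure_inter_preimage_eq_mul {True} {s (n + 1)}
      (measurableSet_singleton _) (measurableSet_singleton _)
    have h₁ : (fun ω => ∀ k ≤ n, drivenChain i₀ (fun ni => U ni ω) k = s k) ⁻¹' {True} =
        {ω | ∀ k ≤ n, drivenChain i₀ (fun ni => U ni ω) k = s k} := by
      ext ω
      simp
    have h₂ : {ω | ∀ k ≤ n, drivenChain i₀ (fun ni => U ni ω) k = s k} ∩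
        U (n + 1, s n) ⁻¹' {s (n + 1)} =
        {ω | ∀ k ≤ n + 1, drivenChain i₀ (fun ni => U ni ω) k = s k} := by
      ext ω
      simp only [Set.mem_inter_iff, Set.mem_ofPred_eq, Set.mem_preimage, Set.mem_singleton_iff]
      refine ⟨fun ⟨h₁, h₂⟩ k hk => ?_, fun h => ⟨fun k hk => h k (by omega), ?_⟩⟩
      · rcases Nat.lt_or_eq_of_le hk with hk | rfl
        · exact h₁ k (by omega)
        · rw [drivenChain, h₁ n le_rfl, h₂]
      · rw [← h (n + 1) le_rfl, drivenChain, h n (by omega)]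
    rw [h₁, h₂] at h
    rw [← hlaw (n + 1) (s n) (s (n + 1)), measureReal_def, h, ENNReal.toReal_mul]
    rfl

namespace SVARModel

variable {p r : ℕ}

/-- Every model has an SVAR process, whatever the initial regime. -/
theorem exists_isSVAR (M : SVARModel p r) (i₀ : Fin r) :
    ∃ (Ω : Type u) (_ : MeasurableSpace Ω) (P : Measure Ω) (_ : IsProbabilityMeasure P)
      (I : ℕ → Ω → Fin r) (ε : ℕ → Fin r → Ω → Fin p → ℝ) (X : ℕ → Ω → Fin p → ℝ),
      M.IsSVAR P I ε X := by
  set τ : Fin r → Measure (Fin r) := fun i => ∑ j, ENNReal.ofReal (M.T i j) • Measure.dirac j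
  have hτ : ∀ i j, τ i {j} = ENNReal.ofReal (M.T i j) := fun i j => by
    simp [τ, Measure.finsetSum_apply, Set.indicator_apply]
  have hτp : ∀ i, IsProbabilityMeasure (τ i) := fun i => ⟨by
    simp [τ, Measure.finsetSum_apply, M.sum_ofReal_T]⟩
  have := M.noise_prob
  -- Moves and noises live on separate factors of a product space, which makes chain and noises
  -- independent.
  obtain ⟨Ω₁, _, P₁, U, _, hUm, hUl, hUi⟩ :=
    exists_iIndepFun_map_eq.{u} fun ni : ℕ × Fin r => τ ni.2
  obtain ⟨Ω₂, _, P₂, e, _, hem, hel, hei⟩ :=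
    exists_iIndepFun_map_eq.{u} fun ni : ℕ × Fin r => M.ν ni.2
  have hfst : MeasurePreserving Prod.fst (P₁.prod P₂) P₁ := measurePreserving_fst
  have hsnd : MeasurePreserving Prod.snd (P₁.prod P₂) P₂ := measurePreserving_snd
  set I : ℕ → Ω₁ × Ω₂ → Fin r := fun n ω => drivenChain i₀ (fun ni => U ni ω.1) n
  set ε : ℕ → Fin r → Ω₁ × Ω₂ → Fin p → ℝ := fun n i ω => e (n, i) ω.2
  refine ⟨Ω₁ × Ω₂, inferInstance, P₁.prod P₂, inferInstance, I, ε,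
    fun n ω => M.zeroStart (fun k => I k ω) (fun ni => ε ni.1 ni.2 ω) n, ?_, ?_, ?_, ?_, ?_, ?_, ?_⟩
  · refine isMarkovChain_drivenChain i₀ (U := fun ni (ω : Ω₁ × Ω₂) => U ni ω.1)
      (hUi.comp_measurePreserving hUm hfst) (fun ni => (hUm ni).comp measurable_fst)
      fun n i j => ?_
    have h₁ : (fun ω : Ω₁ × Ω₂ => U (n, i) ω.1) ⁻¹' {j} =
        Prod.fst ⁻¹' (U (n, i) ⁻¹' {j}) := rfl
    rw [h₁, measureReal_def, hfst.measure_preimage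
      (hUm (n, i) (measurableSet_singleton j)).nullMeasurableSet,
      ← Measure.map_apply (hUm (n, i)) (measurableSet_singleton j), hUl, hτ,
      ENNReal.toReal_ofReal (nonneg_of_mem_rowStochastic M.stochastic)]
  · exact fun n i => (hem (n, i)).comp measurable_snd
  · intro n i
    calc (P₁.prod P₂).map (ε n i) = ((P₁.prod P₂).map Prod.snd).map (e (n, i)) :=
          (Measure.map_map (hem (n, i)) measurable_snd).symm
      _ = M.ν i := by rw [hsnd.map_eq, hel]
  · exact hei.comp_measurePreserving hem hsnd
  · exact indepFun_prod (X := fun ω n => drivenChain i₀ (fun ni => U ni ω) n)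
      (Y := fun ω ni => e ni ω)
      (measurable_pi_lambda _ fun n =>
        (measurable_drivenChain i₀ n).comp (measurable_pi_lambda _ hUm))
      (measurable_pi_lambda _ hem)
  · exact measurable_const
  · intro n ω
    simp [A, E, zeroStart]

/-! ### Tightness and the limit law. -/

variable {M : SVARModel p r} {D : (Fin p → ℝ) → ℝ≥0∞} {c h : Fin r → ℝ≥0∞}
  {θ C : ℝ≥0∞} {s : ℝ}

/-- Markov's inequality for `‖Yₙ‖ ^ s`, whose mean is bounded uniformly in `n`. -/
theorem IsContractingWeight.isTightMeasureSet_zeroStart {Ω : Type*} [MeasurableSpace Ω]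
    {P : Measure Ω} [IsProbabilityMeasure P] {I : ℕ → Ω → Fin r}
    {ε : ℕ → Fin r → Ω → Fin p → ℝ} {X : ℕ → Ω → Fin p → ℝ}
    (hw : M.IsContractingWeight D c h θ C s) (hX : M.IsSVAR P I ε X) :
    IsTightMeasureSet (Set.range fun n => P.map fun ω =>
      M.zeroStart (fun k => I k ω) (fun ni => ε ni.1 ni.2 ω) n) := by
  obtain ⟨K, hK, hmom⟩ := hw.exists_moment_bound hX
  refine isTightMeasureSet_of_tendsto_measure_norm_gt ?_
  have hlim : Tendsto (fun R : ℝ => C * K / ENNReal.ofReal R ^ s) atTop (𝓝 0) := by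
    have h₁ : Tendsto (fun R : ℝ => ENNReal.ofReal R ^ s) atTop (𝓝 ∞) := by
      have h₂ := (ENNReal.continuous_rpow_const (y := s)).tendsto ∞ |>.comp
        ENNReal.tendsto_ofReal_atTop
      rwa [ENNReal.top_rpow_of_pos hw.exponent_pos] at h₂
    have h₂ := ENNReal.Tendsto.const_div (a := C * K) h₁
      (Or.inr (ENNReal.mul_ne_top hw.const_ne_top hK))
    simpa using h₂
  refine tendsto_of_tendsto_of_tendsto_of_le_of_le' tendsto_const_nhds hlim
    (Eventually.of_forall fun R => zero_le) ?_
  filter_upwards [eventually_gt_atTop 0] with R hR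
  refine iSup₂_le ?_
  rintro _ ⟨n, rfl⟩
  have hRs : ENNReal.ofReal R ^ s ≠ 0 := by
    simp [ENNReal.rpow_eq_zero_iff, hR, hw.exponent_pos]
  have hRt : ENNReal.ofReal R ^ s ≠ ∞ :=
    ENNReal.rpow_ne_top_of_nonneg hw.exponent_pos.le ENNReal.ofReal_ne_top
  have hm := hX.measurable_zeroStart n
  rw [Measure.map_apply hm (measurableSet_lt measurable_const measurable_norm)]
  calc _ ≤ P {ω | ENNReal.ofReal R ^ s ≤
        ‖M.zeroStart (fun k => I k ω) (fun ni => ε ni.1 ni.2 ω) n‖ₑ ^ s} := by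
        refine measure_mono fun ω hω => ?_
        simp only [Set.mem_preimage, Set.mem_ofPred_eq] at hω ⊢
        rw [← ofReal_norm]
        exact ENNReal.rpow_le_rpow (ENNReal.ofReal_le_ofReal hω.le) hw.exponent_pos.le
    _ ≤ (∫⁻ ω, ‖M.zeroStart (fun k => I k ω) (fun ni => ε ni.1 ni.2 ω) n‖ₑ ^ s ∂P) /
        ENNReal.ofReal R ^ s :=
        meas_ge_le_lintegral_div (hm.enorm.pow_const s).aemeasurable hRs hRt
    _ ≤ C * K / ENNReal.ofReal R ^ s := by
        gcongr
        refine (lintegral_mono fun ω => (hw.rpow_le _).trans (mul_le_mul_right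
          (le_mul_of_one_le_left' (hw.one_le (I n ω))) C)).trans ?_
        rw [lintegral_const_mul' _ _ hw.const_ne_top]
        gcongr
        exact hmom n

/-- The common weak limit of all the processes started from `0`. -/
theorem IsContractingWeight.exists_limit_zeroStart (hw : M.IsContractingWeight D c h θ C s)
    {ρ : Fin r → ℝ} (hρ : IsStationaryDistribution M.T ρ) :
    ∃ π : ProbabilityMeasure (Fin p → ℝ),
      ∀ (Ω : Type u) [MeasurableSpace Ω] (P : Measure Ω) [IsProbabilityMeasure P]
        (I : ℕ → Ω → Fin r) (ε : ℕ → Fin r → Ω → Fin p → ℝ) (X : ℕ → Ω → Fin p → ℝ),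
        M.IsSVAR P I ε X → TendstoInDistribution
          (fun n ω => M.zeroStart (fun k => I k ω) (fun ni => ε ni.1 ni.2 ω) n) atTop id
          (fun _ => P) (π : Measure (Fin p → ℝ)) := by
  obtain ⟨i₀⟩ : Nonempty (Fin r) := by
    by_contra hr
    have := hρ.sum_eq_one
    rw [not_nonempty_iff] at hr
    simp at this
  obtain ⟨Ω₀, _, P₀, _, I₀, ε₀, X₀, hX₀⟩ := M.exists_isSVAR.{u} i₀
  set κ : ℕ → ProbabilityMeasure (Fin p → ℝ) := fun n => ⟨P₀.map fun ω =>
    M.zeroStart (fun k => I₀ k ω) (fun ni => ε₀ ni.1 ni.2 ω) n,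
    Measure.isProbabilityMeasure_map (hX₀.measurable_zeroStart n).aemeasurable⟩
  have hcompact : IsCompact (closure (Set.range κ)) := by
    refine isCompact_closure_of_isTightMeasureSet ?_
    convert hw.isTightMeasureSet_zeroStart hX₀ using 1
    ext μ
    exact ⟨by rintro ⟨_, ⟨n, rfl⟩, rfl⟩; exact ⟨n, rfl⟩,
      by rintro ⟨n, rfl⟩; exact ⟨κ n, ⟨n, rfl⟩, rfl⟩⟩
  -- A limit along an ultrafilter suffices: the integrals of bounded Lipschitz functions already
  -- converge, so their limits must be the integrals against `π`.
  obtain ⟨π, -, hπ⟩ := hcompact.ultrafilter_le_nhds ((hyperfilter ℕ).map κ)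
    (le_principal_iff.2 (mem_map.2 (univ_mem' fun n => subset_closure ⟨n, rfl⟩)))
  have hπ : Tendsto κ (hyperfilter ℕ) (𝓝 π) := hπ
  refine ⟨π, fun Ω _ P _ I ε X hX => ⟨fun n => (hX.measurable_zeroStart n).aemeasurable,
    aemeasurable_id, ?_⟩⟩
  refine tendsto_iff_forall_lipschitz_integral_tendsto.2 fun f hf hL => ?_
  obtain ⟨l, hl⟩ := hw.exists_tendsto_integral_zeroStart.{u} hρ hf hL
  have hfm : Measurable f := hL.choose_spec.continuous.measurable
  have h₁ : Tendsto (fun n => ∫ x, f x ∂(κ n : Measure (Fin p → ℝ))) (hyperfilter ℕ)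
      (𝓝 (∫ x, f x ∂(π : Measure (Fin p → ℝ)))) :=
    ProbabilityMeasure.tendsto_iff_forall_integral_tendsto.1 hπ
      ⟨⟨f, hL.choose_spec.continuous⟩, hf⟩
  have h₂ : Tendsto (fun n => ∫ x, f x ∂(κ n : Measure (Fin p → ℝ))) (hyperfilter ℕ) (𝓝 l) := by
    refine ((hl Ω₀ P₀ I₀ ε₀ X₀ hX₀).mono_left Nat.hyperfilter_le_atTop).congr fun n => ?_
    exact (integral_map (hX₀.measurable_zeroStart n).aemeasurable hfm.aestronglyMeasurable).symm
  simp only [ProbabilityMeasure.coe_mk, Measure.map_id]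
  rw [tendsto_nhds_unique h₁ h₂]
  refine (hl Ω P I ε X hX).congr fun n => ?_
  exact (integral_map (hX.measurable_zeroStart n).aemeasurable hfm.aestronglyMeasurable).symm

end SVARModel

theorem corollary1 {p r : ℕ} (M : SVARModel p r)
    (ρ : Fin r → ℝ) (hρ : IsStationaryDistribution M.T ρ)
    (N : AlgebraNorm ℝ (Matrix (Fin p) (Fin p) ℝ))
    (hCB : M.expectLogNorm N ρ < 0) :
    SVARModel.IsStable.{u} M := by
  obtain ⟨D, c, h, θ, C, s, hw⟩ := M.exists_isContractingWeight ρ hρ N hCB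
  obtain ⟨π, hπ⟩ := hw.exists_limit_zeroStart.{u} hρ
  have hconv : ∀ (Ω : Type u) [MeasurableSpace Ω] (P : Measure Ω) [IsProbabilityMeasure P]
      (I : ℕ → Ω → Fin r) (ε : ℕ → Fin r → Ω → Fin p → ℝ) (X : ℕ → Ω → Fin p → ℝ),
      M.IsSVAR P I ε X →
        TendstoInDistribution X atTop id (fun _ => P) (π : Measure (Fin p → ℝ)) :=
    fun Ω _ P _ I ε X hX => tendstoInDistribution_of_tendstoInMeasure_sub X id
      (hπ Ω P I ε X hX) (hX.tendstoInMeasure_sub_zeroStart hw)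
      fun n => (hX.measurable n).aemeasurable
  refine ⟨π, hconv, fun π' hπ' => ?_⟩
  -- Uniqueness requires at least one process, hence an initial regime; there is one since `ρ` sums
  -- to `1`.
  obtain ⟨i₀⟩ : Nonempty (Fin r) := by
    by_contra hr
    have := hρ.sum_eq_one
    rw [not_nonempty_iff] at hr
    simp at this
  obtain ⟨Ω, _, P, _, I, ε, X, hX⟩ := M.exists_isSVAR.{u} i₀
  have h := tendstoInDistribution_unique X (hπ' Ω P I ε X hX) (hconv Ω P I ε X hX)
  rw [Measure.map_id, Measure.map_id] at h
  exact Subtype.ext h
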